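/- **Theorem 3.2.** Let $V$ be a real vector space of finite dimension $m\ge 4$ and let $\langle\cdot,\cdot\rangle$ be a non-degenerate symmetric bilinear form on $V$ (of arbitrary signature), with orthogonal group $O(V)=O(V,\langle\cdot,\cdot\rangle)$. The groups $GL(V)$ and $O(V)$ act naturally on $\otimes^kV^*$. For $R\in\otimes^4V^*$ consider the identities, for all $x,y,z,w\in V$: (a) $R(x,y,z,w)=-R(y,x,z,w)$; (b) $R(x,y,z,w)+R(y,z,x,w)+R(z,x,y,w)=0$; (c) $R(x,y,z,w)=R(z,w,x,y)$; (d) $R(x,y,z,w)=-R(x,y,w,z)$. Let $\mathfrak r(V)\subset\otimes^4V^*$ be the space of tensors satisfying (a) and (b), and $\mathfrak a(V)$ the space of tensors satisfying (a)–(d). View $\Lambda^2(V^*)\otimes S^2(V^*)$ as the space of $S\in\otimes^4V^*$ that are antisymmetric in the first two and symmetric in the last two arguments. For a basis $\{e_i\}$ let $(\Xi^{ij})$ be the inverse of the matrix $(\langle e_i,e_j\rangle)$, and put $$\tau(\psi)=\sum_{i,j}\Xi^{ij}\psi(e_i,e_j),\qquad \rho_{14}(R)(x,y)=\sum_{i,j}\Xi^{ij}R(e_i,x,y,e_j).$$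 Let $S^2_0(V^*)=\{\psi\in S^2(V^*):\tau(\psi)=0\}$ and $\mathfrak w(V)=\mathfrak a(V)\cap\ker\rho_{14}$. For $\phi,\psi\in S^2(V^*)$ let $$(\phi\wedge\psi)(x,y,z,w)=\tfrac12\{\phi(x,w)\psi(y,z)-\phi(x,z)\psi(y,w)+\phi(y,z)\psi(x,w)-\phi(y,w)\psi(x,z)\}.$$ Finally let $$(\mathrm{id}\otimes\pi_s)(R)(x,y,z,w)=\tfrac12\{R(x,y,z,w)+R(x,y,w,z)\},$$ $$\sigma_1(S)(x,y,z,w)=S(x,y,z,w)+\tfrac12\{S(z,y,x,w)+S(x,z,y,w)-S(w,y,x,z)-S(x,w,y,z)\},$$ $$\sigma_2(\psi)=\tfrac{2}{m-2}\,\psi\wedge\langle\cdot,\cdot\rangle-\tfrac{\tau(\psi)}{(m-1)(m-2)}\,\langle\cdot,\cdot\rangle\wedge\langle\cdot,\cdot\rangle .$$ 1. If $R\in\otimes^4V^*$ satisfies (a) and (b), then (c) and (d) are equivalent for $R$. 2. The map $\mathrm{id}\otimes\pi_s$ defines a short exact sequence of $GL(V)$-modules $$0\to\mathfrak a(V)\to\mathfrak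 r(V)\xrightarrow{\ \mathrm{id}\otimes\pi_s\ }\Lambda^2(V^*)\otimes S^2(V^*)\to0,$$ which is $GL(V)$-equivariantly split by $\sigma_1$, and $\rho_{14}$ defines a short exact sequence of $O(V)$-modules $$0\to\mathfrak w(V)\to\mathfrak a(V)\xrightarrow{\ \rho_{14}\ }S^2(V^*)\to0,$$ which is $O(V)$-equivariantly split by $\sigma_2$. 3. This gives an isomorphism of $O(V)$-modules $$\mathfrak w(V)\oplus S^2_0(V^*)\oplus\mathbb R\ \cong\ \mathfrak a(V),\qquad (W,\psi,c)\mapsto W+\sigma_2(\psi+c\langle\cdot,\cdot\rangle),$$ where $\mathbb R$ is the trivial module, and the three summands are irreducible $O(V)$-modules. Moreover $$\dim\mathfrak w(V)=\tfrac1{12}m(m+1)(m+2)(m-3),\quad \dim S^2_0(V^*)=\tfrac12(m-1)(m+2),$$ $$\dim\mathbb R=1,\quad \dim\mathfrak a(V)=\tfrac1{12}m^2(m^2-1).$$ -/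

import Mathlib

noncomputable section

namespace AlgCurv

/-! ### Tensors and the natural action of the general linear group -/

/-- `⊗²V*`: bilinear forms `ψ(x, y)`. -/
abbrev Tensor2 (V : Type*) [AddCommGroup V] [Module ℝ V] : Type _ :=
  V →ₗ[ℝ] V →ₗ[ℝ] ℝ

/-- `⊗⁴V*`: quadrilinear forms `R(x, y, z, w)`, in curried form. -/
abbrev Tensor4 (V : Type*) [AddCommGroup V] [Module ℝ V] : Type _ :=
  V →ₗ[ℝ] V →ₗ[ℝ] V →ₗ[ℝ] V →ₗ[ℝ] ℝ

/-! Shortcuts for instances that Mathlib's instance search finds only slowly. -/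

instance instGroup2 (V : Type*) [AddCommGroup V] [Module ℝ V] :
    AddCommGroup (V →ₗ[ℝ] V →ₗ[ℝ] ℝ) :=
  LinearMap.addCommGroup

instance instGroup3 (V : Type*) [AddCommGroup V] [Module ℝ V] :
    AddCommGroup (V →ₗ[ℝ] V →ₗ[ℝ] V →ₗ[ℝ] ℝ) :=
  LinearMap.addCommGroup

instance instGroup4 (V : Type*) [AddCommGroup V] [Module ℝ V] :
    AddCommGroup (V →ₗ[ℝ] V →ₗ[ℝ] V →ₗ[ℝ] V →ₗ[ℝ] ℝ) :=
  LinearMap.addCommGroup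

section Basics

variable {V : Type*} [AddCommGroup V] [Module ℝ V]

/-- A real function of four vectors that is linear in each of them, as an element of `⊗⁴V*`. -/
def Tensor4.of (f : V → V → V → V → ℝ)
    (a₁ : ∀ x x' y z w, f (x + x') y z w = f x y z w + f x' y z w)
    (s₁ : ∀ (c : ℝ) x y z w, f (c • x) y z w = c * f x y z w)
    (a₂ : ∀ x y y' z w, f x (y + y') z w = f x y z w + f x y' z w)
    (s₂ : ∀ (c : ℝ) x y z w, f x (c • y) z w = c * f x y z w)
    (a₃ : ∀ x y z z' w, f x y (z + z') w = f x y z w + f x y z' w)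
    (s₃ : ∀ (c : ℝ) x y z w, f x y (c • z) w = c * f x y z w)
    (a₄ : ∀ x y z w w', f x y z (w + w') = f x y z w + f x y z w')
    (s₄ : ∀ (c : ℝ) x y z w, f x y z (c • w) = c * f x y z w) : Tensor4 V :=
  LinearMap.mk₂ ℝ
    (fun x y => (LinearMap.mk₂ ℝ (f x y) (a₃ x y) (fun c z w => s₃ c x y z w)
      (a₄ x y) (fun c z w => s₄ c x y z w) : V →ₗ[ℝ] V →ₗ[ℝ] ℝ))
    (fun x x' y => by ext z w; simp [a₁]) (fun c x y => by ext z w; simp [s₁])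
    (fun x y y' => by ext z w; simp [a₂]) (fun c x y => by ext z w; simp [s₂])

/-- The defining representation of `GL(V)` on `V`. -/
def stdRep (V : Type*) [AddCommGroup V] [Module ℝ V] : Representation ℝ (V ≃ₗ[ℝ] V) V :=
  LinearEquiv.automorphismGroup.toLinearMapMonoidHom

/-- The natural representation of `GL(V)` on `⊗²V*`. -/
def rep2 (V : Type*) [AddCommGroup V] [Module ℝ V] : Representation ℝ (V ≃ₗ[ℝ] V) (Tensor2 V) :=
  (stdRep V).linHom ((stdRep V).linHom (Representation.trivial ℝ (V ≃ₗ[ℝ] V) ℝ))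

/-- The natural representation of `GL(V)` on `⊗⁴V*`. -/
def rep4 (V : Type*) [AddCommGroup V] [Module ℝ V] : Representation ℝ (V ≃ₗ[ℝ] V) (Tensor4 V) :=
  (stdRep V).linHom ((stdRep V).linHom (rep2 V))

theorem rep2_apply (g : V ≃ₗ[ℝ] V) (ψ : Tensor2 V) (x y : V) :
    rep2 V g ψ x y = ψ (g⁻¹ x) (g⁻¹ y) := rfl

theorem rep4_apply (g : V ≃ₗ[ℝ] V) (R : Tensor4 V) (x y z w : V) :
    rep4 V g R x y z w = R (g⁻¹ x) (g⁻¹ y) (g⁻¹ z) (g⁻¹ w) := rfl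

/-! ### Symmetries of quadrilinear forms -/

/-- `R(x,y,z,w) = -R(y,x,z,w)`. -/
def AntisymmFirst (R : Tensor4 V) : Prop :=
  ∀ x y z w, R x y z w = -R y x z w

/-- The first Bianchi identity. -/
def Bianchi (R : Tensor4 V) : Prop :=
  ∀ x y z w, R x y z w + R y z x w + R z x y w = 0

/-- `R(x,y,z,w) = R(z,w,x,y)`. -/
def PairSymm (R : Tensor4 V) : Prop :=
  ∀ x y z w, R x y z w = R z w x y

/-- `R(x,y,z,w) = -R(x,y,w,z)`. -/
def AntisymmLast (R : Tensor4 V) : Prop :=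
  ∀ x y z w, R x y z w = -R x y w z

/-- `R(x,y,z,w) = R(x,y,w,z)`. -/
def SymmLast (R : Tensor4 V) : Prop :=
  ∀ x y z w, R x y z w = R x y w z

/-! ### The `GL(V)`-modules `𝔯(V)`, `𝔞(V)`, `Λ²(V*) ⊗ S²(V*)`, `S²(V*)` -/

/-- `𝔯(V)`: antisymmetric in the first pair, with the first Bianchi identity. -/
def curv (V : Type*) [AddCommGroup V] [Module ℝ V] : Subrepresentation (rep4 V) where
  toSubmodule :=
    { carrier := {R | AntisymmFirst R ∧ Bianchi R}
      zero_mem' := by constructor <;> intro x y z w <;> simp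
      add_mem' := by
        rintro R R' ⟨h1, h2⟩ ⟨h1', h2'⟩
        refine ⟨fun x y z w => ?_, fun x y z w => ?_⟩ <;> simp only [LinearMap.add_apply]
        · linarith [h1 x y z w, h1' x y z w]
        · linarith [h2 x y z w, h2' x y z w]
      smul_mem' := by
        rintro c R ⟨h1, h2⟩
        refine ⟨fun x y z w => ?_, fun x y z w => ?_⟩ <;>
          simp only [LinearMap.smul_apply, smul_eq_mul]
        · linear_combination c * h1 x y z w
        · linear_combination c * h2 x y z w }
  apply_mem_toSubmodule g R h := ⟨fun _ _ _ _ => h.1 _ _ _ _, fun _ _ _ _ => h.2 _ _ _ _⟩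

/-- `𝔞(V)`: the algebraic curvature tensors. -/
def algCurv (V : Type*) [AddCommGroup V] [Module ℝ V] : Subrepresentation (rep4 V) where
  toSubmodule :=
    { carrier := {A | AntisymmFirst A ∧ Bianchi A ∧ PairSymm A ∧ AntisymmLast A}
      zero_mem' := by refine ⟨?_, ?_, ?_, ?_⟩ <;> intro x y z w <;> simp
      add_mem' := by
        rintro R R' ⟨h1, h2, h3, h4⟩ ⟨h1', h2', h3', h4'⟩
        refine ⟨fun x y z w => ?_, fun x y z w => ?_, fun x y z w => ?_, fun x y z w => ?_⟩ <;>
          simp only [LinearMap.add_apply]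
        · linarith [h1 x y z w, h1' x y z w]
        · linarith [h2 x y z w, h2' x y z w]
        · linarith [h3 x y z w, h3' x y z w]
        · linarith [h4 x y z w, h4' x y z w]
      smul_mem' := by
        rintro c R ⟨h1, h2, h3, h4⟩
        refine ⟨fun x y z w => ?_, fun x y z w => ?_, fun x y z w => ?_, fun x y z w => ?_⟩ <;>
          simp only [LinearMap.smul_apply, smul_eq_mul]
        · linear_combination c * h1 x y z w
        · linear_combination c * h2 x y z w
        · linear_combination c * h3 x y z w
        · linear_combination c * h4 x y z w }
  apply_mem_toSubmodule g R h :=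
    ⟨fun _ _ _ _ => h.1 _ _ _ _, fun _ _ _ _ => h.2.1 _ _ _ _,
      fun _ _ _ _ => h.2.2.1 _ _ _ _, fun _ _ _ _ => h.2.2.2 _ _ _ _⟩

/-- `Λ²(V*) ⊗ S²(V*)` as a submodule of `⊗⁴V*`: the forms that are antisymmetric in the first pair
and symmetric in the last pair (see `altSym_eq_span`). -/
def altSym (V : Type*) [AddCommGroup V] [Module ℝ V] : Subrepresentation (rep4 V) where
  toSubmodule :=
    { carrier := {S | AntisymmFirst S ∧ SymmLast S}
      zero_mem' := by constructor <;> intro x y z w <;> simp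
      add_mem' := by
        rintro R R' ⟨h1, h2⟩ ⟨h1', h2'⟩
        refine ⟨fun x y z w => ?_, fun x y z w => ?_⟩ <;> simp only [LinearMap.add_apply]
        · linarith [h1 x y z w, h1' x y z w]
        · linarith [h2 x y z w, h2' x y z w]
      smul_mem' := by
        rintro c R ⟨h1, h2⟩
        refine ⟨fun x y z w => ?_, fun x y z w => ?_⟩ <;>
          simp only [LinearMap.smul_apply, smul_eq_mul]
        · linear_combination c * h1 x y z w
        · linear_combination c * h2 x y z w }
  apply_mem_toSubmodule g R h := ⟨fun _ _ _ _ => h.1 _ _ _ _, fun _ _ _ _ => h.2 _ _ _ _⟩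

/-- `S²(V*)`: the symmetric bilinear forms. -/
def sym2 (V : Type*) [AddCommGroup V] [Module ℝ V] : Subrepresentation (rep2 V) where
  toSubmodule :=
    { carrier := {ψ | ∀ x y, ψ x y = ψ y x}
      zero_mem' := by intro x y; simp
      add_mem' := by
        intro ψ ψ' h h' x y
        simp only [LinearMap.add_apply]
        linarith [h x y, h' x y]
      smul_mem' := by
        intro c ψ h x y
        simp only [LinearMap.smul_apply, smul_eq_mul]
        linear_combination c * h x y }
  apply_mem_toSubmodule g ψ h := fun _ _ => h _ _

/-- The product `(ω ⊗ ψ)(x,y,z,w) = ω(x,y) ψ(z,w)`. -/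
def tprod (ω ψ : Tensor2 V) : Tensor4 V :=
  Tensor4.of (fun x y z w => ω x y * ψ z w)
    (by intros; simp; ring) (by intros; simp; ring) (by intros; simp; ring) (by intros; simp; ring)
    (by intros; simp; ring) (by intros; simp; ring) (by intros; simp; ring) (by intros; simp; ring)

/-- `altSym V` is spanned by the products of antisymmetric and symmetric bilinear forms. -/
theorem altSym_eq_span [FiniteDimensional ℝ V] :
    (altSym V).toSubmodule =
      Submodule.span ℝ {S | ∃ ω ψ : Tensor2 V, (∀ x y, ω x y = -ω y x) ∧ (∀ x y, ψ x y = ψ y x) ∧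
        S = tprod ω ψ} := by
  apply le_antisymm
  · intro S hS
    let b := Module.finBasis ℝ V
    let ω : Fin (Module.finrank ℝ V) → Fin (Module.finrank ℝ V) → Tensor2 V := fun k l =>
      LinearMap.mk₂ ℝ (fun x y => S x y (b k) (b l)) (by intros; simp) (by intros; simp)
        (by intros; simp) (by intros; simp)
    let ε : Fin (Module.finrank ℝ V) → Fin (Module.finrank ℝ V) → Tensor2 V := fun k l =>
      LinearMap.mk₂ ℝ (fun z w => (1 / 2 : ℝ) * (b.repr z k * b.repr w l + b.repr z l * b.repr w k))
        (by intros; simp; ring) (by intros; simp; ring)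
        (by intros; simp; ring) (by intros; simp; ring)
    have key : S = ∑ k, ∑ l, tprod (ω k l) (ε k l) := by
      ext x y z w
      have h1 : S x y z w = ∑ k, ∑ l, S x y (b k) (b l) * (b.repr z k * b.repr w l) := by
        conv_lhs => rw [← b.sum_repr z, ← b.sum_repr w]
        simp only [map_sum, map_smul, LinearMap.sum_apply, LinearMap.smul_apply, smul_eq_mul,
          Finset.mul_sum]
        rw [Finset.sum_comm]
        refine Finset.sum_congr rfl fun k _ => Finset.sum_congr rfl fun l _ => ?_
        ring
      have h2 : S x y z w = ∑ k, ∑ l, S x y (b k) (b l) * (b.repr z l * b.repr w k) := by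
        rw [h1, Finset.sum_comm]
        refine Finset.sum_congr rfl fun k _ => Finset.sum_congr rfl fun l _ => ?_
        rw [hS.2 x y (b l) (b k)]
      have h3 : (∑ k, ∑ l, tprod (ω k l) (ε k l)) x y z w =
          ∑ k, ∑ l, S x y (b k) (b l) *
            ((1 / 2 : ℝ) * (b.repr z k * b.repr w l + b.repr z l * b.repr w k)) := by
        simp only [LinearMap.sum_apply]
        rfl
      have h4 : S x y z w = (1 / 2 : ℝ) * S x y z w + (1 / 2 : ℝ) * S x y z w := by ring
      rw [h3, h4]
      nth_rewrite 1 [h1]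
      rw [h2]
      simp only [Finset.mul_sum, ← Finset.sum_add_distrib]
      refine Finset.sum_congr rfl fun k _ => Finset.sum_congr rfl fun l _ => ?_
      ring
    rw [key]
    refine Submodule.sum_mem _ fun k _ => Submodule.sum_mem _ fun l _ =>
      Submodule.subset_span ⟨ω k l, ε k l, fun x y => hS.1 _ _ _ _, fun z w => ?_, rfl⟩
    simp only [ε, LinearMap.mk₂_apply]
    ring
  · rw [Submodule.span_le]
    rintro _ ⟨ω, ψ, hω, hψ, rfl⟩
    refine ⟨fun x y z w => ?_, fun x y z w => ?_⟩
    · change ω x y * ψ z w = -(ω y x * ψ z w)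
      rw [hω x y]; ring
    · change ω x y * ψ z w = ω x y * ψ w z
      rw [hψ z w]

/-! ### The maps `id ⊗ π_s` and its splitting -/

/-- `(id ⊗ π_s)(R)(x,y,z,w) = ½ (R(x,y,z,w) + R(x,y,w,z))`. -/
def idSym (R : Tensor4 V) : Tensor4 V :=
  Tensor4.of (fun x y z w => (1 / 2 : ℝ) * (R x y z w + R x y w z))
    (by intros; simp; ring) (by intros; simp; ring) (by intros; simp; ring) (by intros; simp; ring)
    (by intros; simp; ring) (by intros; simp; ring) (by intros; simp; ring) (by intros; simp; ring)

/-- `σ(S)(x,y,z,w) = S(x,y,z,w) + ½ (S(z,y,x,w) + S(x,z,y,w) - S(w,y,x,z) - S(x,w,y,z))`. -/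
def idSymSplit (S : Tensor4 V) : Tensor4 V :=
  Tensor4.of
    (fun x y z w => S x y z w + (1 / 2 : ℝ) * (S z y x w + S x z y w - S w y x z - S x w y z))
    (by intros; simp; ring) (by intros; simp; ring) (by intros; simp; ring) (by intros; simp; ring)
    (by intros; simp; ring) (by intros; simp; ring) (by intros; simp; ring) (by intros; simp; ring)

/-- The product `φ ∧ ψ` of bilinear forms, with the factor `½`. -/
def wedge (φ ψ : Tensor2 V) : Tensor4 V :=
  Tensor4.of
    (fun x y z w => (1 / 2 : ℝ) * (φ x w * ψ y z - φ x z * ψ y w + φ y z * ψ x w - φ y w * ψ x z))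
    (by intros; simp; ring) (by intros; simp; ring) (by intros; simp; ring) (by intros; simp; ring)
    (by intros; simp; ring) (by intros; simp; ring) (by intros; simp; ring) (by intros; simp; ring)

theorem idSym_apply (R : Tensor4 V) (x y z w : V) :
    idSym R x y z w = (1 / 2 : ℝ) * (R x y z w + R x y w z) := rfl

theorem idSymSplit_apply (S : Tensor4 V) (x y z w : V) :
    idSymSplit S x y z w =
      S x y z w + (1 / 2 : ℝ) * (S z y x w + S x z y w - S w y x z - S x w y z) := rfl

theorem wedge_apply (φ ψ : Tensor2 V) (x y z w : V) :
    wedge φ ψ x y z w =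
      (1 / 2 : ℝ) * (φ x w * ψ y z - φ x z * ψ y w + φ y z * ψ x w - φ y w * ψ x z) := rfl

end Basics

/-! ### Traces with respect to a non-degenerate form, and the orthogonal group -/

section Metric

variable {V : Type*} [AddCommGroup V] [Module ℝ V]

/-- The orthogonal group `O(V, B)` of a bilinear form `B`. -/
def orthogonalGroup (B : LinearMap.BilinForm ℝ V) : Subgroup (V ≃ₗ[ℝ] V) where
  carrier := {g | ∀ x y, B (g x) (g y) = B x y}
  one_mem' := fun _ _ => rfl
  mul_mem' := fun {g h} hg hh x y => (hg (h x) (h y)).trans (hh x y)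
  inv_mem' := fun {g} hg x y => by
    have h := hg (g⁻¹ x) (g⁻¹ y)
    have e : ∀ v, g (g⁻¹ v) = v := fun v => g.apply_symm_apply v
    rw [e, e] at h
    exact h.symm

/-- The natural representation of `O(V, B)` on `⊗²V*`. -/
def orep2 (B : LinearMap.BilinForm ℝ V) : Representation ℝ (orthogonalGroup B) (Tensor2 V) :=
  (rep2 V).comp (orthogonalGroup B).subtype

/-- The natural representation of `O(V, B)` on `⊗⁴V*`. -/
def orep4 (B : LinearMap.BilinForm ℝ V) : Representation ℝ (orthogonalGroup B) (Tensor4 V) :=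
  (rep4 V).comp (orthogonalGroup B).subtype

variable [FiniteDimensional ℝ V]

/-- `τ(ψ)`: the trace of the endomorphism `E` of `V` with `B (E x) y = ψ x y`, that is
`∑ᵢⱼ Ξⁱʲ ψ(eᵢ, eⱼ)` with `(Ξⁱʲ)` the inverse of the Gram matrix of `B` in any basis
(see `metricTrace_eq_sum`). -/
def metricTrace (B : LinearMap.BilinForm ℝ V) (hB : B.Nondegenerate) : Tensor2 V →ₗ[ℝ] ℝ where
  toFun ψ := LinearMap.trace ℝ V ((B.toDual hB).symm.toLinearMap ∘ₗ ψ)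
  map_add' ψ ψ' := by rw [LinearMap.comp_add, map_add]
  map_smul' c ψ := by rw [LinearMap.comp_smul, map_smul]; rfl

/-- `ρ₁₄(R)(y,z) = ∑ᵢⱼ Ξⁱʲ R(eᵢ, y, z, eⱼ)`: the trace of `R` in its first and last arguments. -/
def rho14 (B : LinearMap.BilinForm ℝ V) (hB : B.Nondegenerate) : Tensor4 V →ₗ[ℝ] Tensor2 V where
  toFun R := LinearMap.mk₂ ℝ (fun y z => metricTrace B hB ((R.flip y).flip z))
    (fun y y' z => by
      rw [← map_add]; congr 1; ext; simp)
    (fun c y z => by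
      rw [← map_smul]; congr 1; ext; simp)
    (fun y z z' => by
      rw [← map_add]; congr 1; ext; simp)
    (fun c y z => by
      rw [← map_smul]; congr 1; ext; simp)
  map_add' R R' := by
    ext y z
    simp only [LinearMap.mk₂_apply, LinearMap.add_apply]
    rw [← map_add]; congr 1
  map_smul' c R := by
    ext y z
    simp only [LinearMap.mk₂_apply, LinearMap.smul_apply, RingHom.id_apply]
    rw [← map_smul]; congr 1

theorem metricTrace_eq_sum {ι : Type*} [Fintype ι] [DecidableEq ι] (b : Module.Basis ι ℝ V)
    (B : LinearMap.BilinForm ℝ V) (hB : B.Nondegenerate) (hsymm : B.IsSymm) (ψ : Tensor2 V) :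
    metricTrace B hB ψ =
      ∑ i, ∑ j, (Matrix.of fun i j => B (b i) (b j))⁻¹ i j * ψ (b i) (b j) := by
  set E : V →ₗ[ℝ] V := (B.toDual hB).symm.toLinearMap ∘ₗ ψ with hE
  set G : Matrix ι ι ℝ := Matrix.of fun i j => B (b i) (b j) with hG
  have hEψ : ∀ x y, B (E x) y = ψ x y := fun x y =>
    LinearMap.BilinForm.apply_toDual_symm_apply (hB := hB) (ψ x) y
  have hdet : IsUnit G.det := by
    have : G = LinearMap.BilinForm.toMatrix b B := by
      ext i j; simp [hG, LinearMap.BilinForm.toMatrix_apply]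
    rw [this]
    exact isUnit_iff_ne_zero.mpr ((LinearMap.BilinForm.nondegenerate_iff_det_ne_zero b).mp hB)
  have hsym : G.transpose = G := by
    ext i j
    exact hsymm.eq (b j) (b i)
  have hΨ : (Matrix.of fun i j => ψ (b i) (b j)) = (LinearMap.toMatrix b b E).transpose * G := by
    ext i j
    rw [Matrix.of_apply, ← hEψ]
    conv_lhs => rw [← b.sum_repr (E (b i))]
    simp only [map_sum, map_smul, LinearMap.sum_apply, LinearMap.smul_apply, smul_eq_mul]
    rw [Matrix.mul_apply]
    refine Finset.sum_congr rfl fun k _ => ?_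
    rw [Matrix.transpose_apply, LinearMap.toMatrix_apply, hG, Matrix.of_apply]
  have h1 : (LinearMap.toMatrix b b E).transpose =
      (Matrix.of fun i j => ψ (b i) (b j)) * G⁻¹ := by
    rw [hΨ, Matrix.mul_assoc, Matrix.mul_nonsing_inv _ hdet, Matrix.mul_one]
  change LinearMap.trace ℝ V E = _
  rw [LinearMap.trace_eq_matrix_trace ℝ b E, ← Matrix.trace_transpose, h1, Matrix.trace]
  refine Finset.sum_congr rfl fun i _ => ?_
  rw [Matrix.diag_apply, Matrix.mul_apply]
  refine Finset.sum_congr rfl fun j _ => ?_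
  have : G⁻¹ j i = G⁻¹ i j := by
    have h := congrFun (congrFun (Matrix.transpose_nonsing_inv G) i) j
    rw [hsym] at h
    exact h
  rw [this, Matrix.of_apply, mul_comm]

theorem rho14_eq_sum {ι : Type*} [Fintype ι] [DecidableEq ι] (b : Module.Basis ι ℝ V)
    (B : LinearMap.BilinForm ℝ V) (hB : B.Nondegenerate) (hsymm : B.IsSymm) (R : Tensor4 V)
    (y z : V) :
    rho14 B hB R y z =
      ∑ i, ∑ j, (Matrix.of fun i j => B (b i) (b j))⁻¹ i j * R (b i) y z (b j) :=
  metricTrace_eq_sum b B hB hsymm ((R.flip y).flip z)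

theorem metricTrace_orep2 (B : LinearMap.BilinForm ℝ V) (hB : B.Nondegenerate)
    (g : orthogonalGroup B) (ψ : Tensor2 V) :
    metricTrace B hB (orep2 B g ψ) = metricTrace B hB ψ := by
  have key : (B.toDual hB).symm.toLinearMap ∘ₗ (orep2 B g ψ) =
      (g : V ≃ₗ[ℝ] V).conj ((B.toDual hB).symm.toLinearMap ∘ₗ ψ) := by
    ext x
    apply (B.toDual hB).injective
    ext y
    have e : (g : V ≃ₗ[ℝ] V) ((g : V ≃ₗ[ℝ] V)⁻¹ y) = y := (g : V ≃ₗ[ℝ] V).apply_symm_apply y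
    rw [LinearMap.BilinForm.toDual_def, LinearMap.BilinForm.toDual_def]
    have l : B (((B.toDual hB).symm.toLinearMap ∘ₗ (orep2 B g ψ)) x) y = orep2 B g ψ x y :=
      LinearMap.BilinForm.apply_toDual_symm_apply (hB := hB) (orep2 B g ψ x) y
    rw [l]
    conv_rhs => rw [← e]
    rw [LinearEquiv.conj_apply_apply]
    refine Eq.trans ?_ (g.2 _ _).symm
    exact (LinearMap.BilinForm.apply_toDual_symm_apply (hB := hB)
      (ψ ((g : V ≃ₗ[ℝ] V)⁻¹ x)) ((g : V ≃ₗ[ℝ] V)⁻¹ y)).symm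
  change LinearMap.trace ℝ V _ = LinearMap.trace ℝ V _
  rw [key, LinearMap.trace_conj']

theorem rho14_orep4 (B : LinearMap.BilinForm ℝ V) (hB : B.Nondegenerate)
    (g : orthogonalGroup B) (R : Tensor4 V) :
    rho14 B hB (orep4 B g R) = orep2 B g (rho14 B hB R) := by
  ext y z
  exact metricTrace_orep2 B hB g
    ((R.flip ((g : V ≃ₗ[ℝ] V)⁻¹ y)).flip ((g : V ≃ₗ[ℝ] V)⁻¹ z))

/-! ### The `O(V, B)`-modules `𝔞(V)`, `S²(V*)`, `𝔴(V, B)`, `S₀²(V*, B)` -/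

/-- `𝔞(V)` as an `O(V, B)`-module. -/
def oAlgCurv (B : LinearMap.BilinForm ℝ V) : Subrepresentation (orep4 B) where
  toSubmodule := (algCurv V).toSubmodule
  apply_mem_toSubmodule g _ h := (algCurv V).apply_mem_toSubmodule (g : V ≃ₗ[ℝ] V) h

/-- `S²(V*)` as an `O(V, B)`-module. -/
def oSym2 (B : LinearMap.BilinForm ℝ V) : Subrepresentation (orep2 B) where
  toSubmodule := (sym2 V).toSubmodule
  apply_mem_toSubmodule g _ h := (sym2 V).apply_mem_toSubmodule (g : V ≃ₗ[ℝ] V) h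

/-- `𝔴(V, B) = ker ρ₁₄ ∩ 𝔞(V)`: the Weyl conformal curvature tensors. -/
def weyl (B : LinearMap.BilinForm ℝ V) (hB : B.Nondegenerate) : Subrepresentation (orep4 B) where
  toSubmodule := LinearMap.ker (rho14 B hB) ⊓ (algCurv V).toSubmodule
  apply_mem_toSubmodule g R h := by
    refine ⟨?_, (oAlgCurv B).apply_mem_toSubmodule g h.2⟩
    have h1 : rho14 B hB R = 0 := h.1
    change rho14 B hB (orep4 B g R) = 0
    rw [rho14_orep4, h1, map_zero]

/-- `S₀²(V*, B)`: the symmetric bilinear forms with `τ(ψ) = 0`. -/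
def sym2Zero (B : LinearMap.BilinForm ℝ V) (hB : B.Nondegenerate) :
    Subrepresentation (orep2 B) where
  toSubmodule := LinearMap.ker (metricTrace B hB) ⊓ (sym2 V).toSubmodule
  apply_mem_toSubmodule g ψ h := by
    refine ⟨?_, (oSym2 B).apply_mem_toSubmodule g h.2⟩
    have h1 : metricTrace B hB ψ = 0 := h.1
    change metricTrace B hB (orep2 B g ψ) = 0
    rw [metricTrace_orep2, h1]

/-- `σ(ψ) = 2/(m-2) ψ ∧ B - τ(ψ)/((m-1)(m-2)) B ∧ B`, where `m = dim V`. -/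
def rho14Split (B : LinearMap.BilinForm ℝ V) (hB : B.Nondegenerate) (ψ : Tensor2 V) : Tensor4 V :=
  (2 / ((Module.finrank ℝ V : ℝ) - 2)) • wedge ψ B -
    (metricTrace B hB ψ / (((Module.finrank ℝ V : ℝ) - 1) * ((Module.finrank ℝ V : ℝ) - 2))) •
      wedge B B

end Metric

/-! ### Equivariantly split short exact sequences -/

/-- `0 → X → Y → Z → 0` (maps `i`, `p`) is a short exact sequence of representations of `G`,
split by the equivariant map `s : Z → Y`. -/
structure IsSplitShortExact {G X Y Z : Type*} [Group G]
    [AddCommGroup X] [Module ℝ X] [AddCommGroup Y] [Module ℝ Y] [AddCommGroup Z] [Module ℝ Z]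
    {ρX : Representation ℝ G X} {ρY : Representation ℝ G Y} {ρZ : Representation ℝ G Z}
    (i : ρX.IntertwiningMap ρY) (p : ρY.IntertwiningMap ρZ) (s : ρZ.IntertwiningMap ρY) :
    Prop where
  injective : Function.Injective i
  exact : Function.Exact i p
  surjective : Function.Surjective p
  split : ∀ v, p (s v) = v

end AlgCurv

end

noncomputable section

/-! The sequences rest on a few identities. Given (a), (b) and (d), the Bianchi identities for the
four cyclic shifts of the arguments combine to (c). Hence 𝔞(V) is exactly the kernel of `idSym` on
𝔯(V). For the trace sequence the one computation is `rho14_wedge_self`, ρ₁₄(ψ ∧ B) = ½(τ(ψ) B + (m -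
2) ψ), which dictates the coefficients of `rho14Split`. Splitting S²(V*) once more into trace-free
forms and multiples of B gives the isomorphism.

Irreducibility has to be proved in every signature, where an invariant subspace may meet its
orthogonal complement. The criterion `isIrreducible_of_forall_mem` avoids this: if one non-isotropic
vector t lies in all nonzero invariant subspaces, then a proper nonzero one and its complement would
both contain t, so t would be orthogonal to itself. In an orthogonal basis, t is the product of two
distinct coordinates for S₀², and `wedgeSym` of four distinct coordinates for 𝔴. The nonzero
components of t all carry permutations of the same indices, so its square is a nonzero weight times
a sum of squares.

Two kinds of isometries suffice to find t in a nonzero invariant N: sign flips of one basis vector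
(`exists_flip`), and isometries mixing two basis vectors with four nonzero coefficients
(`exists_rotation`). Mixing and the vanishing trace show that some element of N has a nonzero
component with distinct indices; flips cut away all components with other indices; mixing again
produces t and carries it from one set of indices to another.

The dimensions of S², Λ² ⊗ S² and 𝔯 are traces of projections written as combinations of
permutations of the arguments; such a permutation has as trace the number of index tuples it fixes.
The other dimensions follow from the exact sequences and the isomorphism. -/

namespace AlgCurv

/-! ### Equivariant maps between subrepresentations -/

section Restrict

variable {G X Y : Type*} [Group G] [AddCommGroup X] [Module ℝ X] [AddCommGroup Y] [Module ℝ Y]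
  {ρ : Representation ℝ G X} {σ : Representation ℝ G Y}

/-- An equivariant linear map that carries a subrepresentation into another one, as a map between
these. -/
def restrictIntertwining (U : Subrepresentation ρ) (W : Subrepresentation σ) (f : X →ₗ[ℝ] Y)
    (hf : ∀ g v, f (ρ g v) = σ g (f v)) (hUW : ∀ v ∈ U.toSubmodule, f v ∈ W.toSubmodule) :
    U.toRepresentation.IntertwiningMap W.toRepresentation :=
  LinearMap.intertwiningMap_of_isIntertwiningMap U.toRepresentation W.toRepresentation
    (f.restrict hUW) fun g v => Subtype.ext (hf g v)

theorem restrictIntertwining_injective (U : Subrepresentation ρ) (W : Subrepresentation σ)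
    (f : X →ₗ[ℝ] Y) (hf : ∀ g v, f (ρ g v) = σ g (f v))
    (hUW : ∀ v ∈ U.toSubmodule, f v ∈ W.toSubmodule) (h : Function.Injective f) :
    Function.Injective (restrictIntertwining U W f hf hUW) := fun v v' hv =>
  Subtype.ext (h (show f v = f v' from Subtype.ext_iff.1 hv))

end Restrict

/-! ### The `GL(V)`-equivariant sequence -/

section GeneralLinear

variable {V : Type*} [AddCommGroup V] [Module ℝ V]

theorem Tensor4.ext4 {R S : Tensor4 V} (h : ∀ x y z w, R x y z w = S x y z w) : R = S := by
  ext x y z w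
  exact h x y z w

theorem antisymmLast_of_pairSymm {R : Tensor4 V} (ha : AntisymmFirst R) (hc : PairSymm R) :
    AntisymmLast R := fun x y z w => by
  rw [hc x y z w, ha z w x y, hc w z x y]

/-- With both antisymmetries, the Bianchi identities that keep w, x, y, z last involve only six
components up to sign. The first two minus the other two leave 2(R(x,y,z,w) - R(z,w,x,y)) = 0. -/
theorem pairSymm_of_antisymmLast {R : Tensor4 V} (ha : AntisymmFirst R) (hb : Bianchi R)
    (hd : AntisymmLast R) : PairSymm R := fun x y z w => by
  linarith [hb x y z w, hb y z w x, hb z w x y, hb w x y z, ha x y z w, ha y z x w, ha z x y w,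
    ha y z w x, ha z w y x, ha w y z x, ha z w x y, ha w x z y, ha x z w y, ha w x y z,
    ha x y w z, ha y w x z, hd x y z w, hd y z x w, hd z x y w, hd x z y w, hd w y z x, hd y w z x,
    hd z w x y, hd w x z y, hd x w y z, hd x w z y, hd z w y x]

theorem pairSymm_iff_antisymmLast {R : Tensor4 V} (ha : AntisymmFirst R) (hb : Bianchi R) :
    PairSymm R ↔ AntisymmLast R :=
  ⟨antisymmLast_of_pairSymm ha, pairSymm_of_antisymmLast ha hb⟩

theorem mem_algCurv_of_antisymmLast {R : Tensor4 V} (ha : AntisymmFirst R) (hb : Bianchi R)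
    (hd : AntisymmLast R) : R ∈ (algCurv V).toSubmodule :=
  ⟨ha, hb, pairSymm_of_antisymmLast ha hb hd, hd⟩

/-- `idSym` as a linear map. -/
def idSymLinear (V : Type*) [AddCommGroup V] [Module ℝ V] : Tensor4 V →ₗ[ℝ] Tensor4 V where
  toFun := idSym
  map_add' R S := Tensor4.ext4 fun x y z w => by
    simp only [idSym_apply, LinearMap.add_apply]; ring
  map_smul' c R := Tensor4.ext4 fun x y z w => by
    simp only [idSym_apply, LinearMap.smul_apply, smul_eq_mul, RingHom.id_apply]; ring

/-- `idSymSplit` as a linear map. -/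
def idSymSplitLinear (V : Type*) [AddCommGroup V] [Module ℝ V] : Tensor4 V →ₗ[ℝ] Tensor4 V where
  toFun := idSymSplit
  map_add' R S := Tensor4.ext4 fun x y z w => by
    simp only [idSymSplit_apply, LinearMap.add_apply]; ring
  map_smul' c R := Tensor4.ext4 fun x y z w => by
    simp only [idSymSplit_apply, LinearMap.smul_apply, smul_eq_mul, RingHom.id_apply]; ring

theorem idSym_mem_altSym {R : Tensor4 V} (hR : AntisymmFirst R) :
    idSym R ∈ (altSym V).toSubmodule := by
  refine ⟨fun x y z w => ?_, fun x y z w => ?_⟩ <;> simp only [idSym_apply]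
  · linarith [hR x y z w, hR x y w z]
  · ring

/-- For Bianchi, the terms with w last are S(x,y,z,w) minus half of its two other cyclic shifts, so
they cancel in the cyclic sum; the terms with w in the first pair cancel by symmetry in the last
pair. -/
theorem idSymSplit_mem_curv {S : Tensor4 V} (hS : S ∈ (altSym V).toSubmodule) :
    idSymSplit S ∈ (curv V).toSubmodule := by
  obtain ⟨ha, hs⟩ := hS
  refine ⟨fun x y z w => ?_, fun x y z w => ?_⟩ <;> simp only [idSymSplit_apply]
  · linarith [ha x y z w, ha x z y w, ha y z x w, ha x w y z, ha y w x z]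
  · linarith [ha x y z w, ha y z x w, ha z x y w, ha w x y z, ha w y z x, ha w z x y,
      hs w x y z, hs w y z x, hs w z x y]

/-- The correction that `idSymSplit` adds to S is antisymmetric in z, w, so the symmetrization kills
it. -/
theorem idSym_idSymSplit {S : Tensor4 V} (hS : S ∈ (altSym V).toSubmodule) :
    idSym (idSymSplit S) = S := Tensor4.ext4 fun x y z w => by
  simp only [idSym_apply, idSymSplit_apply]
  linarith [hS.2 x y z w]

theorem idSym_eq_zero_iff (R : Tensor4 V) : idSym R = 0 ↔ AntisymmLast R := by
  refine ⟨fun h x y z w => ?_, fun h => Tensor4.ext4 fun x y z w => ?_⟩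
  · have := LinearMap.congr_fun₂ (LinearMap.congr_fun₂ h x y) z w
    simp only [idSym_apply, LinearMap.zero_apply] at this
    linarith
  · simp only [idSym_apply, LinearMap.zero_apply]
    linarith [h x y z w]

theorem exists_isSplitShortExact_curv :
    ∃ (i : (algCurv V).toRepresentation.IntertwiningMap (curv V).toRepresentation)
      (p : (curv V).toRepresentation.IntertwiningMap (altSym V).toRepresentation)
      (s : (altSym V).toRepresentation.IntertwiningMap (curv V).toRepresentation),
      (∀ A, (i A : Tensor4 V) = A) ∧
      (∀ R, (p R : Tensor4 V) = idSym (R : Tensor4 V)) ∧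
      (∀ S, (s S : Tensor4 V) = idSymSplit (S : Tensor4 V)) ∧
      IsSplitShortExact i p s := by
  refine ⟨restrictIntertwining (algCurv V) (curv V) LinearMap.id (fun _ _ => rfl)
      fun R hR => ⟨hR.1, hR.2.1⟩,
    restrictIntertwining (curv V) (altSym V) (idSymLinear V) (fun _ _ => rfl)
      fun R hR => idSym_mem_altSym hR.1,
    restrictIntertwining (altSym V) (curv V) (idSymSplitLinear V) (fun _ _ => rfl)
      fun S hS => idSymSplit_mem_curv hS,
    fun _ => rfl, fun _ => rfl, fun _ => rfl, ?_⟩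
  have hp : ∀ S : (altSym V).toSubmodule, idSym (idSymSplit (S : Tensor4 V)) = S :=
    fun S => idSym_idSymSplit S.2
  refine ⟨restrictIntertwining_injective _ _ _ _ _ Function.injective_id, fun R => ⟨fun h => ?_, ?_⟩,
    fun S => ⟨⟨_, idSymSplit_mem_curv S.2⟩, Subtype.ext (hp S)⟩, fun S => Subtype.ext (hp S)⟩
  · have h' : idSym (R : Tensor4 V) = 0 := congrArg Subtype.val h
    exact ⟨⟨R, mem_algCurv_of_antisymmLast R.2.1 R.2.2 ((idSym_eq_zero_iff _).1 h')⟩,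
      Subtype.ext rfl⟩
  · rintro ⟨A, rfl⟩
    exact Subtype.ext ((idSym_eq_zero_iff _).2 A.2.2.2.2)

end GeneralLinear

/-! ### Traces in an orthogonal basis, the `O(V, B)`-equivariant sequence and the decomposition -/

section Metric

variable {V : Type*} [AddCommGroup V] [Module ℝ V] 
  {B : LinearMap.BilinForm ℝ V} {ι : Type*} [Fintype ι]

theorem self_mem_sym2 (hsymm : B.IsSymm) : B ∈ (sym2 V).toSubmodule := fun x y => hsymm.eq x y

theorem wedge_mem_algCurv {φ ψ : Tensor2 V} (hφ : φ ∈ (sym2 V).toSubmodule)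
    (hψ : ψ ∈ (sym2 V).toSubmodule) : wedge φ ψ ∈ (algCurv V).toSubmodule := by
  have h1 : ∀ x y, φ x y = φ y x := hφ
  have h2 : ∀ x y, ψ x y = ψ y x := hψ
  refine mem_algCurv_of_antisymmLast (fun x y z w => ?_) (fun x y z w => ?_)
    (fun x y z w => ?_) <;> simp only [wedge_apply]
  · ring
  · rw [h1 y x, h1 z x, h1 z y, h2 y x, h2 z x, h2 z y]
    ring
  · ring

theorem orep2_self (g : orthogonalGroup B) : orep2 B g B = B := by
  ext x y
  exact (orthogonalGroup B).inv_mem g.2 x y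

theorem orep4_wedge (g : orthogonalGroup B) (φ ψ : Tensor2 V) :
    orep4 B g (wedge φ ψ) = wedge (orep2 B g φ) (orep2 B g ψ) := rfl

theorem orthogonal_basis_apply_self_ne_zero (hB : B.Nondegenerate) {b : Module.Basis ι ℝ V}
    (hb : ∀ i j, i ≠ j → B (b i) (b j) = 0) (i : ι) : B (b i) (b i) ≠ 0 := by
  intro h
  refine b.ne_zero i (hB.1 (b i) fun y => ?_)
  rw [← b.sum_repr y, map_sum]
  refine Finset.sum_eq_zero fun j _ => ?_
  rw [map_smul]
  rcases eq_or_ne i j with rfl | hij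
  · simp [h]
  · simp [hb i j hij]

/-- This is f applied to the expansion of y in an orthogonal basis, the coefficients being B(y, bᵢ)
/ B(bᵢ, bᵢ). The basis is not normalized, so the same formulas serve all signatures. -/
theorem sum_orthogonal_basis (hB : B.Nondegenerate) {b : Module.Basis ι ℝ V}
    (hb : ∀ i j, i ≠ j → B (b i) (b j) = 0) (f : V →ₗ[ℝ] ℝ) (y : V) :
    ∑ i, (B (b i) (b i))⁻¹ * (f (b i) * B y (b i)) = f y := by
  conv_rhs => rw [← b.sum_repr y, map_sum]
  refine Finset.sum_congr rfl fun i _ => ?_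
  have h : B y (b i) = b.repr y i * B (b i) (b i) := by
    conv_lhs => rw [← b.sum_repr y]
    rw [map_sum, LinearMap.sum_apply, Finset.sum_eq_single i]
    · simp
    · intro j _ hj
      simp [hb j i hj]
    · simp
  have := orthogonal_basis_apply_self_ne_zero hB hb i
  rw [h, map_smul, smul_eq_mul]
  field_simp

variable [FiniteDimensional ℝ V]

theorem exists_orthogonal_basis (hsymm : B.IsSymm) :
    ∃ b : Module.Basis (Fin (Module.finrank ℝ V)) ℝ V, ∀ i j, i ≠ j → B (b i) (b j) = 0 := by
  obtain ⟨b, hb⟩ := LinearMap.BilinForm.exists_orthogonal_basis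
    (LinearMap.BilinForm.isSymm_iff.1 hsymm)
  exact ⟨b, fun i j hij => hb hij⟩

variable [DecidableEq ι]

theorem metricTrace_eq_sum_orthogonal (hB : B.Nondegenerate) (hsymm : B.IsSymm)
    {b : Module.Basis ι ℝ V} (hb : ∀ i j, i ≠ j → B (b i) (b j) = 0) (ψ : Tensor2 V) :
    metricTrace B hB ψ = ∑ i, (B (b i) (b i))⁻¹ * ψ (b i) (b i) := by
  have hG : (Matrix.of fun i j => B (b i) (b j)) = Matrix.diagonal fun i => B (b i) (b i) := by
    ext i j
    rcases eq_or_ne i j with rfl | hij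
    · simp
    · simp [hij, hb i j hij]
  have hinv : (Matrix.diagonal fun i => B (b i) (b i))⁻¹ =
      Matrix.diagonal fun i => (B (b i) (b i))⁻¹ := by
    refine Matrix.inv_eq_right_inv ?_
    rw [Matrix.diagonal_mul_diagonal, ← Matrix.diagonal_one]
    congr 1
    ext i
    exact mul_inv_cancel₀ (orthogonal_basis_apply_self_ne_zero hB hb i)
  rw [metricTrace_eq_sum b B hB hsymm, hG, hinv]
  refine Finset.sum_congr rfl fun i _ => ?_
  rw [Finset.sum_eq_single i]
  · simp
  · intro j _ hj
    simp [hj.symm]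
  · simp

theorem rho14_eq_sum_orthogonal (hB : B.Nondegenerate) (hsymm : B.IsSymm)
    {b : Module.Basis ι ℝ V} (hb : ∀ i j, i ≠ j → B (b i) (b j) = 0) (R : Tensor4 V) (y z : V) :
    rho14 B hB R y z = ∑ i, (B (b i) (b i))⁻¹ * R (b i) y z (b i) :=
  metricTrace_eq_sum_orthogonal hB hsymm hb ((R.flip y).flip z)

theorem metricTrace_self (hB : B.Nondegenerate) (hsymm : B.IsSymm) :
    metricTrace B hB B = Module.finrank ℝ V := by
  obtain ⟨b, hb⟩ := exists_orthogonal_basis hsymm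
  rw [metricTrace_eq_sum_orthogonal hB hsymm hb]
  simp [inv_mul_cancel₀ (orthogonal_basis_apply_self_ne_zero hB hb _)]

/-- Of the four terms of the product, one contracts to τ(ψ) B, one to τ(B) ψ = m ψ, and the two
mixed ones to -ψ each. -/
theorem rho14_wedge_self (hB : B.Nondegenerate) (hsymm : B.IsSymm) {ψ : Tensor2 V}
    (hψ : ψ ∈ (sym2 V).toSubmodule) :
    rho14 B hB (wedge ψ B) =
      (1 / 2 : ℝ) • (metricTrace B hB ψ • B + ((Module.finrank ℝ V : ℝ) - 2) • ψ) := by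
  obtain ⟨b, hb⟩ := exists_orthogonal_basis hsymm
  ext y z
  have hs : ∀ x y, ψ x y = ψ y x := hψ
  have h1 := sum_orthogonal_basis hB hb (ψ z) y
  have h2 := sum_orthogonal_basis hB hb (ψ y) z
  have h3 := metricTrace_eq_sum_orthogonal hB hsymm hb ψ
  have h4 := metricTrace_eq_sum_orthogonal hB hsymm hb B
  rw [metricTrace_self hB hsymm] at h4
  have e : ∀ i, (B (b i) (b i))⁻¹ * wedge ψ B (b i) y z (b i) =
      (1 / 2 : ℝ) * ((B (b i) (b i))⁻¹ * ψ (b i) (b i) * B y z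
        - (B (b i) (b i))⁻¹ * (ψ z (b i) * B y (b i))
        + (B (b i) (b i))⁻¹ * B (b i) (b i) * ψ y z
        - (B (b i) (b i))⁻¹ * (ψ y (b i) * B z (b i))) := fun i => by
    have hB' : B (b i) z = B z (b i) := hsymm.eq _ _
    rw [wedge_apply, hs (b i) z, hB']
    ring
  rw [rho14_eq_sum_orthogonal hB hsymm hb, Finset.sum_congr rfl fun i _ => e i, ← Finset.mul_sum]
  simp only [Finset.sum_sub_distrib, Finset.sum_add_distrib]
  rw [h1, h2, ← Finset.sum_mul, ← Finset.sum_mul, ← h3, ← h4, hs z y]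
  simp only [LinearMap.add_apply, LinearMap.smul_apply, smul_eq_mul]
  ring

/-- The first term contributes ψ + τ(ψ)/(m - 2) B. Since ρ₁₄(B ∧ B) = (m - 1) B, the second removes
exactly the multiple of B. -/
theorem rho14_rho14Split (hm : 4 ≤ Module.finrank ℝ V) (hB : B.Nondegenerate) (hsymm : B.IsSymm)
    {ψ : Tensor2 V} (hψ : ψ ∈ (sym2 V).toSubmodule) : rho14 B hB (rho14Split B hB ψ) = ψ := by
  have hm' : (4 : ℝ) ≤ Module.finrank ℝ V := by exact_mod_cast hm
  rw [rho14Split, map_sub, map_smul, map_smul, rho14_wedge_self hB hsymm hψ,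
    rho14_wedge_self hB hsymm (self_mem_sym2 hsymm), metricTrace_self hB hsymm]
  ext y z
  simp only [LinearMap.add_apply, LinearMap.sub_apply, LinearMap.smul_apply, smul_eq_mul]
  have h1 : (Module.finrank ℝ V : ℝ) - 1 ≠ 0 := by linarith
  have h2 : (Module.finrank ℝ V : ℝ) - 2 ≠ 0 := by linarith
  field_simp
  ring

theorem rho14Split_mem_algCurv (hB : B.Nondegenerate) (hsymm : B.IsSymm) {ψ : Tensor2 V}
    (hψ : ψ ∈ (sym2 V).toSubmodule) : rho14Split B hB ψ ∈ (algCurv V).toSubmodule :=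
  Submodule.sub_mem _ (Submodule.smul_mem _ _ (wedge_mem_algCurv hψ (self_mem_sym2 hsymm)))
    (Submodule.smul_mem _ _ (wedge_mem_algCurv (self_mem_sym2 hsymm) (self_mem_sym2 hsymm)))

theorem rho14_mem_sym2 (hB : B.Nondegenerate) (hsymm : B.IsSymm) {R : Tensor4 V}
    (hR : R ∈ (algCurv V).toSubmodule) : rho14 B hB R ∈ (sym2 V).toSubmodule := by
  obtain ⟨b, hb⟩ := exists_orthogonal_basis hsymm
  intro y z
  rw [rho14_eq_sum_orthogonal hB hsymm hb, rho14_eq_sum_orthogonal hB hsymm hb]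
  refine Finset.sum_congr rfl fun i _ => ?_
  rw [hR.2.2.1 (b i) y z (b i), hR.1 z, hR.2.2.2 (b i) z, neg_neg]

/-- `rho14Split` as a linear map. -/
def rho14SplitLinear (B : LinearMap.BilinForm ℝ V) (hB : B.Nondegenerate) :
    Tensor2 V →ₗ[ℝ] Tensor4 V where
  toFun := rho14Split B hB
  map_add' φ ψ := Tensor4.ext4 fun x y z w => by
    simp only [rho14Split, wedge_apply, map_add, LinearMap.add_apply, LinearMap.sub_apply,
      LinearMap.smul_apply, smul_eq_mul]
    ring
  map_smul' c ψ := Tensor4.ext4 fun x y z w => by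
    simp only [rho14Split, wedge_apply, map_smul, LinearMap.sub_apply,
      LinearMap.smul_apply, smul_eq_mul, RingHom.id_apply]
    ring

theorem rho14Split_orep2 (hB : B.Nondegenerate) (g : orthogonalGroup B) (ψ : Tensor2 V) :
    rho14Split B hB (orep2 B g ψ) = orep4 B g (rho14Split B hB ψ) := by
  rw [rho14Split, rho14Split, metricTrace_orep2, map_sub, map_smul, map_smul, orep4_wedge,
    orep4_wedge, orep2_self]

theorem exists_isSplitShortExact_oAlgCurv (hm : 4 ≤ Module.finrank ℝ V) (hsymm : B.IsSymm)
    (hB : B.Nondegenerate) :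
    ∃ (i : (weyl B hB).toRepresentation.IntertwiningMap (oAlgCurv B).toRepresentation)
      (p : (oAlgCurv B).toRepresentation.IntertwiningMap (oSym2 B).toRepresentation)
      (s : (oSym2 B).toRepresentation.IntertwiningMap (oAlgCurv B).toRepresentation),
      (∀ A, (i A : Tensor4 V) = A) ∧
      (∀ A, (p A : Tensor2 V) = rho14 B hB (A : Tensor4 V)) ∧
      (∀ ψ, (s ψ : Tensor4 V) = rho14Split B hB (ψ : Tensor2 V)) ∧
      IsSplitShortExact i p s := by
  refine ⟨restrictIntertwining (weyl B hB) (oAlgCurv B) LinearMap.id (fun _ _ => rfl)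
      fun R hR => hR.2,
    restrictIntertwining (oAlgCurv B) (oSym2 B) (rho14 B hB) (fun g R => rho14_orep4 B hB g R)
      fun R hR => rho14_mem_sym2 hB hsymm hR,
    restrictIntertwining (oSym2 B) (oAlgCurv B) (rho14SplitLinear B hB)
      (fun g ψ => rho14Split_orep2 hB g ψ) fun ψ hψ => rho14Split_mem_algCurv hB hsymm hψ,
    fun _ => rfl, fun _ => rfl, fun _ => rfl, ?_⟩
  have hp : ∀ ψ : (oSym2 B).toSubmodule, rho14 B hB (rho14Split B hB (ψ : Tensor2 V)) = ψ :=
    fun ψ => rho14_rho14Split hm hB hsymm ψ.2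
  refine ⟨restrictIntertwining_injective _ _ _ _ _ Function.injective_id, fun R => ⟨fun h => ?_, ?_⟩,
    fun ψ => ⟨⟨_, rho14Split_mem_algCurv hB hsymm ψ.2⟩, Subtype.ext (hp ψ)⟩,
    fun ψ => Subtype.ext (hp ψ)⟩
  · have h' : rho14 B hB (R : Tensor4 V) = 0 := congrArg Subtype.val h
    exact ⟨⟨R, h', R.2⟩, Subtype.ext rfl⟩
  · rintro ⟨A, rfl⟩
    exact Subtype.ext A.2.1

theorem exists_equiv_oAlgCurv (hm : 4 ≤ Module.finrank ℝ V) (hsymm : B.IsSymm)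
    (hB : B.Nondegenerate) :
    ∃ e : Representation.Equiv
        ((weyl B hB).toRepresentation.prod
          ((sym2Zero B hB).toRepresentation.prod
            (Representation.trivial ℝ (orthogonalGroup B) ℝ)))
        (oAlgCurv B).toRepresentation,
      ∀ W ψ c, (e (W, ψ, c) : Tensor4 V) =
        (W : Tensor4 V) + rho14Split B hB ((ψ : Tensor2 V) + c • B) := by
  have hm' : (4 : ℝ) ≤ Module.finrank ℝ V := by exact_mod_cast hm
  have hm0 : (Module.finrank ℝ V : ℝ) ≠ 0 := by linarith
  have hmem : ∀ (ψ : (sym2Zero B hB).toSubmodule) (c : ℝ),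
      (ψ : Tensor2 V) + c • B ∈ (sym2 V).toSubmodule := fun ψ c =>
    Submodule.add_mem _ ψ.2.2 (Submodule.smul_mem _ c (self_mem_sym2 hsymm))
  let f : (weyl B hB).toSubmodule × ((sym2Zero B hB).toSubmodule × ℝ) →ₗ[ℝ] Tensor4 V :=
    (weyl B hB).toSubmodule.subtype.coprod (rho14SplitLinear B hB ∘ₗ
      (sym2Zero B hB).toSubmodule.subtype.coprod (LinearMap.toSpanSingleton ℝ (Tensor2 V) B))
  have hf : ∀ W ψ c, f (W, ψ, c) =
      (W : Tensor4 V) + rho14Split B hB ((ψ : Tensor2 V) + c • B) := fun _ _ _ => rfl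
  have hfm : ∀ v, f v ∈ (oAlgCurv B).toSubmodule := fun v =>
    Submodule.add_mem _ v.1.2.2 (rho14Split_mem_algCurv hB hsymm (hmem v.2.1 v.2.2))
  have hρ : ∀ W ψ c, rho14 B hB (f (W, ψ, c)) = (ψ : Tensor2 V) + c • B := fun W ψ c => by
    have hW : rho14 B hB (W : Tensor4 V) = 0 := W.2.1
    rw [hf, map_add, hW, zero_add, rho14_rho14Split hm hB hsymm (hmem ψ c)]
  have hτ : ∀ (ψ : (sym2Zero B hB).toSubmodule) (c : ℝ),
      metricTrace B hB ((ψ : Tensor2 V) + c • B) = c * Module.finrank ℝ V := fun ψ c => by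
    have hψ : metricTrace B hB (ψ : Tensor2 V) = 0 := ψ.2.1
    rw [map_add, hψ, map_smul, metricTrace_self hB hsymm, zero_add, smul_eq_mul]
  let F := f.codRestrict (oAlgCurv B).toSubmodule hfm
  have hF : Function.Bijective F := by
    constructor
    -- Applying `rho14` recovers ψ + c B, the trace of which is c m; so c, then ψ, then W vanish.
    · rw [injective_iff_map_eq_zero]
      rintro ⟨W, ψ, c⟩ h
      have h0 : f (W, ψ, c) = 0 := congrArg Subtype.val h
      have h1 := hρ W ψ c
      rw [h0, map_zero] at h1
      have h2 := hτ ψ c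
      rw [← h1, map_zero] at h2
      have hc : c = 0 := by
        rcases mul_eq_zero.1 h2.symm with h | h
        · exact h
        · exact absurd h hm0
      subst hc
      rw [zero_smul, add_zero] at h1
      have hψ : ψ = 0 := Subtype.ext h1.symm
      subst hψ
      rw [hf, zero_smul, add_zero] at h0
      have h3 : rho14Split B hB ((0 : (sym2Zero B hB).toSubmodule) : Tensor2 V) = 0 :=
        map_zero (rho14SplitLinear B hB)
      rw [h3, add_zero] at h0
      have hW : W = 0 := Subtype.ext h0
      rw [hW]
      rfl
    · intro R
      have hR : (R : Tensor4 V) ∈ (algCurv V).toSubmodule := R.2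
      have hψ := rho14_mem_sym2 hB hsymm hR
      set ψ := rho14 B hB (R : Tensor4 V) with hψdef
      -- As τ(B) = m, this c makes ψ - c B trace-free.
      set c := metricTrace B hB ψ / Module.finrank ℝ V with hc
      have hψ0 : ψ - c • B ∈ (sym2Zero B hB).toSubmodule := by
        refine ⟨?_, Submodule.sub_mem _ hψ (Submodule.smul_mem _ c (self_mem_sym2 hsymm))⟩
        change metricTrace B hB (ψ - c • B) = 0
        rw [map_sub, map_smul, metricTrace_self hB hsymm, smul_eq_mul, hc]
        field_simp
        ring
      have hW : (R : Tensor4 V) - rho14Split B hB ψ ∈ (weyl B hB).toSubmodule := by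
        refine ⟨?_, Submodule.sub_mem _ hR (rho14Split_mem_algCurv hB hsymm hψ)⟩
        change rho14 B hB (R - rho14Split B hB ψ) = 0
        rw [map_sub, rho14_rho14Split hm hB hsymm hψ, ← hψdef, sub_self]
      refine ⟨(⟨_, hW⟩, ⟨_, hψ0⟩, c), Subtype.ext ?_⟩
      change f _ = _
      rw [hf]
      simp only [sub_add_cancel]
  refine ⟨Representation.Equiv.mk (LinearEquiv.ofBijective F hF) fun g => ?_, fun _ _ _ => rfl⟩
  refine LinearMap.ext fun ⟨W, ψ, c⟩ => Subtype.ext ?_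
  change orep4 B g W + rho14Split B hB (orep2 B g ψ + c • B) =
    orep4 B g (W + rho14Split B hB ((ψ : Tensor2 V) + c • B))
  rw [map_add (orep4 B g), ← rho14Split_orep2, map_add (orep2 B g), map_smul (orep2 B g),
    orep2_self]

end Metric

/-! ### Criteria for irreducibility -/

/-- A subrepresentation `W` is irreducible if some vector `t` that is not isotropic for an
invariant symmetric form lies in every nonzero invariant subspace of `W`. -/
theorem isIrreducible_of_forall_mem {G X : Type*} [Group G] [AddCommGroup X] [Module ℝ X]
    [FiniteDimensional ℝ X] {ρ : Representation ℝ G X} (W : Subrepresentation ρ)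
    (b : LinearMap.BilinForm ℝ X) (hb : ∀ g x y, b (ρ g x) (ρ g y) = b x y)
    (t : X) (ht : b t t ≠ 0) (htW : t ∈ W.toSubmodule)
    (h : ∀ N : Submodule ℝ X, N ≤ W.toSubmodule → (∀ g, ∀ x ∈ N, ρ g x ∈ N) → N ≠ ⊥ → t ∈ N) :
    W.toRepresentation.IsIrreducible := by
  have ht0 : t ≠ 0 := by
    rintro rfl
    simp at ht
  have hne : (⊥ : Subrepresentation W.toRepresentation) ≠ ⊤ := fun e => by
    have : (⟨t, htW⟩ : W.toSubmodule) ∈ (⊥ : Subrepresentation W.toRepresentation) :=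
      e ▸ Submodule.mem_top
    exact ht0 (congrArg Subtype.val ((Submodule.mem_bot ℝ).1 this))
  have key : ∀ M : Subrepresentation W.toRepresentation, M.toSubmodule ≠ ⊥ →
      (⟨t, htW⟩ : W.toSubmodule) ∈ M.toSubmodule := fun M hM => by
    obtain ⟨x, hx, hxt⟩ := h (M.toSubmodule.map W.toSubmodule.subtype)
      (Submodule.map_subtype_le _ _) (by
        rintro g _ ⟨x, hx, rfl⟩
        exact ⟨_, M.apply_mem_toSubmodule g hx, rfl⟩) fun e =>
          hM (Submodule.map_injective_of_injective (Submodule.subtype_injective _)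
            (e.trans (Submodule.map_bot _).symm))
    have : x = ⟨t, htW⟩ := Subtype.ext hxt
    exact this ▸ hx
  refine { exists_pair_ne := ⟨⊥, ⊤, hne⟩, eq_bot_or_eq_top := fun M => ?_ }
  by_contra! hM
  let c : LinearMap.BilinForm ℝ W.toSubmodule := b.restrict W.toSubmodule
  -- The orthogonal complement of M is invariant, but it need not be a linear complement of M.
  let P : Subrepresentation W.toRepresentation :=
    { toSubmodule := c.orthogonal M.toSubmodule
      apply_mem_toSubmodule := fun g v hv m hm => by
        have h1 : c (W.toRepresentation g⁻¹ m) v = 0 := hv _ (M.apply_mem_toSubmodule g⁻¹ hm)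
        have h2 := hb g (ρ g⁻¹ m) v
        have h3 : ρ g (ρ g⁻¹ (m : X)) = m := ρ.self_inv_apply g _
        rw [h3] at h2
        exact h2.trans h1 }
  have hMbot : M.toSubmodule ≠ ⊥ := fun e => hM.1 (Subrepresentation.toSubmodule_injective e)
  -- The dimensions of M and its complement add up to at least that of W, even if the restricted
  -- form is degenerate. So a zero complement would force M = W.
  have hPbot : P.toSubmodule ≠ ⊥ := fun e => by
    have h1 := c.finrank_add_finrank_orthogonal' M.toSubmodule
    have h2 : c.orthogonal M.toSubmodule = ⊥ := e
    rw [h2, finrank_bot] at h1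
    refine hM.2 (Subrepresentation.toSubmodule_injective
      (Submodule.eq_top_of_finrank_eq (le_antisymm (Submodule.finrank_le _) ?_)))
    omega
  -- Now t lies both in M and in its complement, which gives b(t, t) = 0.
  exact ht ((key P hPbot) _ (key M hMbot))

theorem isIrreducible_trivial (G : Type*) [Group G] :
    (Representation.trivial ℝ G ℝ).IsIrreducible := by
  have hne : (⊥ : Subrepresentation (Representation.trivial ℝ G ℝ)) ≠ ⊤ := fun e =>
    bot_ne_top (α := Submodule ℝ ℝ) (congrArg Subrepresentation.toSubmodule e)
  refine { exists_pair_ne := ⟨⊥, ⊤, hne⟩, eq_bot_or_eq_top := fun M => ?_ }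
  exact (eq_bot_or_eq_top M.toSubmodule).imp (fun e => Subrepresentation.toSubmodule_injective e)
    fun e => Subrepresentation.toSubmodule_injective e

/-! ### Dimensions as traces of idempotents -/

theorem finrank_eq_trace {X : Type*} [AddCommGroup X] [Module ℝ X] [FiniteDimensional ℝ X]
    (W : Submodule ℝ X) (f : X →ₗ[ℝ] X) (h1 : ∀ x, f x ∈ W) (h2 : ∀ x ∈ W, f x = x) :
    (Module.finrank ℝ W : ℝ) = LinearMap.trace ℝ X f :=
  (LinearMap.IsProj.trace ⟨h1, h2⟩).symm

theorem trace_funLeft {n : Type*} [Fintype n] [DecidableEq n] (s : n → n) :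
    LinearMap.trace ℝ (n → ℝ) (LinearMap.funLeft ℝ ℝ s) =
      ∑ i, if s i = i then 1 else 0 := by
  rw [LinearMap.trace_eq_matrix_trace ℝ (Pi.basisFun ℝ n), Matrix.trace]
  refine Finset.sum_congr rfl fun i _ => ?_
  simp [LinearMap.funLeft_apply, Pi.single_apply]

section Dimension

variable {V : Type*} [AddCommGroup V] [Module ℝ V]

/-- Exchange of the first two arguments. -/
def swap12 : Tensor4 V →ₗ[ℝ] Tensor4 V where
  toFun R := R.flip
  map_add' _ _ := rfl
  map_smul' _ _ := rfl

/-- Exchange of the second and the third argument. -/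
def swap23 : Tensor4 V →ₗ[ℝ] Tensor4 V where
  toFun R := Tensor4.of (fun x y z w => R x z y w)
    (by intros; simp) (by intros; simp) (by intros; simp) (by intros; simp)
    (by intros; simp) (by intros; simp) (by intros; simp) (by intros; simp)
  map_add' _ _ := rfl
  map_smul' _ _ := rfl

/-- Exchange of the last two arguments. -/
def swap34 : Tensor4 V →ₗ[ℝ] Tensor4 V where
  toFun R := Tensor4.of (fun x y z w => R x y w z)
    (by intros; simp) (by intros; simp) (by intros; simp) (by intros; simp)
    (by intros; simp) (by intros; simp) (by intros; simp) (by intros; simp)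
  map_add' _ _ := rfl
  map_smul' _ _ := rfl

theorem swap12_apply (R : Tensor4 V) (x y z w : V) : swap12 R x y z w = R y x z w := rfl

theorem swap23_apply (R : Tensor4 V) (x y z w : V) : swap23 R x y z w = R x z y w := rfl

theorem swap34_apply (R : Tensor4 V) (x y z w : V) : swap34 R x y z w = R x y w z := rfl

variable [FiniteDimensional ℝ V] {ι : Type*} [Fintype ι] (b : Module.Basis ι ℝ V)

/-- The components of a quadrilinear form in a basis. -/
def coord4 : Tensor4 V ≃ₗ[ℝ] (ι × ι × ι × ι → ℝ) :=
  LinearEquiv.ofInjectiveOfFinrankEq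
    { toFun := fun R p => R (b p.1) (b p.2.1) (b p.2.2.1) (b p.2.2.2)
      map_add' := fun _ _ => rfl
      map_smul' := fun _ _ => rfl }
    (fun R S h => b.ext fun i => b.ext fun j => b.ext fun k => b.ext fun l =>
      congrFun h (i, j, k, l))
    (by simp [Module.finrank_linearMap, Module.finrank_eq_card_basis b])

/-- The components of a bilinear form in a basis. -/
def coord2 : Tensor2 V ≃ₗ[ℝ] (ι × ι → ℝ) :=
  LinearEquiv.ofInjectiveOfFinrankEq
    { toFun := fun ψ p => ψ (b p.1) (b p.2)
      map_add' := fun _ _ => rfl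
      map_smul' := fun _ _ => rfl }
    (fun R S h => b.ext fun i => b.ext fun j => congrFun h (i, j))
    (by simp [Module.finrank_linearMap, Module.finrank_eq_card_basis b])

/-- In coordinates f merely relabels the entries, so its trace counts the fixed labels. For a
permutation of tensor arguments this is m to the number of its cycles. -/
theorem trace_eq_of_coord {X n : Type*} [AddCommGroup X] [Module ℝ X] [Fintype n]
    [DecidableEq n] (e : X ≃ₗ[ℝ] (n → ℝ)) (f : X →ₗ[ℝ] X) (s : n → n)
    (h : ∀ x i, e (f x) i = e x (s i)) :
    LinearMap.trace ℝ X f = ∑ i, if s i = i then 1 else 0 := by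
  have : e.conj f = LinearMap.funLeft ℝ ℝ s := by
    refine LinearMap.ext fun x => ?_
    obtain ⟨x, rfl⟩ := e.surjective x
    ext i
    rw [LinearEquiv.conj_apply_apply, e.symm_apply_apply, h]
    rfl
  rw [← trace_funLeft, ← this, LinearMap.trace_conj']

theorem finrank_sym2 :
    (Module.finrank ℝ (sym2 V).toSubmodule : ℝ) =
      1 / 2 * Module.finrank ℝ V * (Module.finrank ℝ V + 1) := by
  classical
  let b := Module.finBasis ℝ V
  let flip : Tensor2 V →ₗ[ℝ] Tensor2 V := LinearMap.lflip.toLinearMap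
  have hflip : LinearMap.trace ℝ _ flip = Module.finrank ℝ V := by
    rw [trace_eq_of_coord (coord2 b) flip (fun p => (p.2, p.1)) fun _ _ => rfl]
    simp only [Fintype.sum_prod_type, Prod.mk.injEq, ite_and]
    simp
  have hid : LinearMap.trace ℝ _ (LinearMap.id : Tensor2 V →ₗ[ℝ] Tensor2 V) =
      (Module.finrank ℝ V : ℝ) ^ 2 := by
    rw [LinearMap.trace_id]
    simp [Module.finrank_linearMap, sq]
  rw [finrank_eq_trace _ ((1 / 2 : ℝ) • (LinearMap.id + flip)), map_smul, map_add, hid, hflip,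
    smul_eq_mul]
  · ring
  · intro ψ x y
    change (1 / 2 : ℝ) * (ψ x y + ψ y x) = (1 / 2 : ℝ) * (ψ y x + ψ x y)
    ring
  · intro ψ hψ
    ext x y
    change (1 / 2 : ℝ) * (ψ x y + ψ y x) = ψ x y
    rw [hψ y x]
    ring

theorem trace_id_tensor4 : LinearMap.trace ℝ _ (LinearMap.id : Tensor4 V →ₗ[ℝ] Tensor4 V) =
    (Module.finrank ℝ V : ℝ) ^ 4 := by
  rw [LinearMap.trace_id]
  simp only [Module.finrank_linearMap, Module.finrank_self]
  push_cast
  ring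

theorem trace_swap12 : LinearMap.trace ℝ _ (swap12 : Tensor4 V →ₗ[ℝ] Tensor4 V) =
    (Module.finrank ℝ V : ℝ) ^ 3 := by
  rw [trace_eq_of_coord (coord4 (Module.finBasis ℝ V)) _ (fun p => (p.2.1, p.1, p.2.2))
    fun _ _ => rfl]
  simp only [Fintype.sum_prod_type, Prod.mk.injEq, ite_and]
  simp
  ring

theorem trace_swap23 : LinearMap.trace ℝ _ (swap23 : Tensor4 V →ₗ[ℝ] Tensor4 V) =
    (Module.finrank ℝ V : ℝ) ^ 3 := by
  rw [trace_eq_of_coord (coord4 (Module.finBasis ℝ V)) _ (fun p => (p.1, p.2.2.1, p.2.1, p.2.2.2))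
    fun _ _ => rfl]
  simp only [Fintype.sum_prod_type, Prod.mk.injEq, ite_and]
  simp
  ring

theorem trace_swap34 : LinearMap.trace ℝ _ (swap34 : Tensor4 V →ₗ[ℝ] Tensor4 V) =
    (Module.finrank ℝ V : ℝ) ^ 3 := by
  rw [trace_eq_of_coord (coord4 (Module.finBasis ℝ V)) _ (fun p => (p.1, p.2.1, p.2.2.2, p.2.2.1))
    fun _ _ => rfl]
  simp only [Fintype.sum_prod_type, Prod.mk.injEq, ite_and]
  simp
  ring

theorem trace_swap12_mul_swap34 :
    LinearMap.trace ℝ _ (swap12 ∘ₗ swap34 : Tensor4 V →ₗ[ℝ] Tensor4 V) =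
      (Module.finrank ℝ V : ℝ) ^ 2 := by
  rw [trace_eq_of_coord (coord4 (Module.finBasis ℝ V)) _ (fun p => (p.2.1, p.1, p.2.2.2, p.2.2.1))
    fun _ _ => rfl]
  simp only [Fintype.sum_prod_type, Prod.mk.injEq, ite_and]
  simp
  ring

theorem trace_swap12_mul_swap23 :
    LinearMap.trace ℝ _ (swap12 ∘ₗ swap23 : Tensor4 V →ₗ[ℝ] Tensor4 V) =
      (Module.finrank ℝ V : ℝ) ^ 2 := by
  rw [trace_eq_of_coord (coord4 (Module.finBasis ℝ V)) _ (fun p => (p.2.1, p.2.2.1, p.1, p.2.2.2))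
    fun _ _ => rfl]
  simp only [Fintype.sum_prod_type, Prod.mk.injEq, ite_and]
  simp
  ring

theorem finrank_altSym :
    (Module.finrank ℝ (altSym V).toSubmodule : ℝ) =
      1 / 4 * (Module.finrank ℝ V) ^ 2 * ((Module.finrank ℝ V) ^ 2 - 1) := by
  -- The product of the commuting projections ½(1 - (12)) and ½(1 + (34)).
  rw [finrank_eq_trace _ ((1 / 4 : ℝ) • (LinearMap.id - swap12 + swap34 - swap12 ∘ₗ swap34)),
    map_smul, map_sub, map_add, map_sub, trace_id_tensor4, trace_swap12, trace_swap34,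
    trace_swap12_mul_swap34, smul_eq_mul]
  · ring
  · intro R
    constructor <;> intro x y z w <;>
    simp only [LinearMap.smul_apply, LinearMap.sub_apply, LinearMap.add_apply, LinearMap.comp_apply,
      LinearMap.id_apply, swap12_apply, swap34_apply, smul_eq_mul] <;> ring
  · intro R hR
    refine Tensor4.ext4 fun x y z w => ?_
    simp only [LinearMap.smul_apply, LinearMap.sub_apply, LinearMap.add_apply, LinearMap.comp_apply,
      LinearMap.id_apply, swap12_apply, swap34_apply, smul_eq_mul]
    linarith [hR.1 x y z w, hR.2 x y z w, hR.1 x y w z]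

/-- For tensors antisymmetric in the first pair, Bianchi says that the totally antisymmetric part in
the first three arguments vanishes. So the projection is ½(1 - (12)) minus the antisymmetrizer of
these three arguments. -/
theorem finrank_curv :
    (Module.finrank ℝ (curv V).toSubmodule : ℝ) =
      1 / 3 * (Module.finrank ℝ V) ^ 2 * ((Module.finrank ℝ V) ^ 2 - 1) := by
  -- The exchange (13) is conjugate to (23), so it has the same trace.
  have h13 : LinearMap.trace ℝ _ (swap12 ∘ₗ swap23 ∘ₗ swap12 : Tensor4 V →ₗ[ℝ] Tensor4 V) =
      (Module.finrank ℝ V : ℝ) ^ 3 := by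
    rw [LinearMap.trace_comp_comm', LinearMap.comp_assoc]
    exact trace_swap23
  have h132 : LinearMap.trace ℝ _ (swap23 ∘ₗ swap12 : Tensor4 V →ₗ[ℝ] Tensor4 V) =
      (Module.finrank ℝ V : ℝ) ^ 2 := by
    rw [LinearMap.trace_comp_comm']
    exact trace_swap12_mul_swap23
  rw [finrank_eq_trace _ ((1 / 3 : ℝ) • (LinearMap.id - swap12) + (1 / 6 : ℝ) •
      (swap23 + swap12 ∘ₗ swap23 ∘ₗ swap12 - swap12 ∘ₗ swap23 - swap23 ∘ₗ swap12)),
    map_add, map_smul, map_smul, map_sub, map_sub, map_sub, map_add, trace_id_tensor4,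
    trace_swap12, trace_swap23, trace_swap12_mul_swap23, h13, h132, smul_eq_mul, smul_eq_mul]
  · ring
  · intro R
    constructor <;> intro x y z w <;>
    simp only [LinearMap.smul_apply, LinearMap.sub_apply, LinearMap.add_apply, LinearMap.comp_apply,
      LinearMap.id_apply, swap12_apply, swap23_apply, smul_eq_mul] <;> ring
  · intro R hR
    refine Tensor4.ext4 fun x y z w => ?_
    simp only [LinearMap.smul_apply, LinearMap.sub_apply, LinearMap.add_apply, LinearMap.comp_apply,
      LinearMap.id_apply, swap12_apply, swap23_apply, smul_eq_mul]
    linarith [hR.1 x y z w, hR.2 x y z w, hR.1 x z y w, hR.1 y z x w, hR.1 z x y w]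

theorem finrank_algCurv :
    (Module.finrank ℝ (algCurv V).toSubmodule : ℝ) =
      1 / 12 * (Module.finrank ℝ V) ^ 2 * ((Module.finrank ℝ V) ^ 2 - 1) := by
  obtain ⟨i, p, s, -, -, -, h⟩ := exists_isSplitShortExact_curv (V := V)
  have h1 := LinearMap.finrank_range_add_finrank_ker p.toLinearMap
  have h2 : LinearMap.range p.toLinearMap = ⊤ := LinearMap.range_eq_top.2 h.surjective
  have h3 : LinearMap.ker p.toLinearMap = LinearMap.range i.toLinearMap :=
    LinearMap.exact_iff.1 h.exact
  rw [h2, h3, finrank_top, LinearMap.finrank_range_of_inj h.injective] at h1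
  have h4 : (Module.finrank ℝ (altSym V).toSubmodule : ℝ) +
      Module.finrank ℝ (algCurv V).toSubmodule = Module.finrank ℝ (curv V).toSubmodule := by
    exact_mod_cast h1
  rw [finrank_altSym, finrank_curv] at h4
  linarith

theorem finrank_sym2Zero_and_weyl (hm : 4 ≤ Module.finrank ℝ V) {B : LinearMap.BilinForm ℝ V}
    (hsymm : B.IsSymm) (hB : B.Nondegenerate) :
    (Module.finrank ℝ (sym2Zero B hB).toSubmodule : ℝ) + 1 =
        Module.finrank ℝ (sym2 V).toSubmodule ∧
      (Module.finrank ℝ (weyl B hB).toSubmodule : ℝ) + Module.finrank ℝ (sym2 V).toSubmodule =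
        Module.finrank ℝ (algCurv V).toSubmodule := by
  obtain ⟨e, -⟩ := exists_equiv_oAlgCurv hm hsymm hB
  have h0 := e.toLinearEquiv.finrank_eq
  obtain ⟨i, p, s, -, -, -, h⟩ := exists_isSplitShortExact_oAlgCurv hm hsymm hB
  have h1 := LinearMap.finrank_range_add_finrank_ker p.toLinearMap
  have h2 : LinearMap.range p.toLinearMap = ⊤ := LinearMap.range_eq_top.2 h.surjective
  have h3 : LinearMap.ker p.toLinearMap = LinearMap.range i.toLinearMap :=
    LinearMap.exact_iff.1 h.exact
  rw [h2, h3, finrank_top, LinearMap.finrank_range_of_inj h.injective] at h1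
  rw [Module.finrank_prod, Module.finrank_prod, Module.finrank_self] at h0
  have h4 : Module.finrank ℝ (sym2 V).toSubmodule + Module.finrank ℝ (weyl B hB).toSubmodule =
    Module.finrank ℝ (algCurv V).toSubmodule := h1
  have h5 : Module.finrank ℝ (weyl B hB).toSubmodule +
      (Module.finrank ℝ (sym2Zero B hB).toSubmodule + 1) =
    Module.finrank ℝ (algCurv V).toSubmodule := h0
  constructor
  · have : Module.finrank ℝ (sym2Zero B hB).toSubmodule + 1 =
      Module.finrank ℝ (sym2 V).toSubmodule := by omega
    exact_mod_cast this
  · rw [add_comm]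
    exact_mod_cast h4

end Dimension

/-! ### Isometries that flip one basis vector or mix two -/

section Reflection

variable {V : Type*} [AddCommGroup V] [Module ℝ V] {B : LinearMap.BilinForm ℝ V}

/-- The reflection `x ↦ x - 2 B(x, v) / B(v, v) v`. -/
def reflectionMap (B : LinearMap.BilinForm ℝ V) (v : V) : V →ₗ[ℝ] V :=
  LinearMap.id - (2 / B v v) • (B.flip v).smulRight v

theorem reflectionMap_apply (v x : V) :
    reflectionMap B v x = x - (2 / B v v * B x v) • v := by
  simp [reflectionMap, smul_smul]

theorem reflectionMap_involutive {v : V} (hv : B v v ≠ 0) :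
    Function.Involutive (reflectionMap B v) := fun x => by
  rw [reflectionMap_apply v x, map_sub, map_smul, reflectionMap_apply, reflectionMap_apply,
    div_mul_cancel₀ _ hv]
  module

theorem apply_reflectionMap (hsymm : B.IsSymm) {v : V} (hv : B v v ≠ 0) (x y : V) :
    B (reflectionMap B v x) (reflectionMap B v y) = B x y := by
  simp only [reflectionMap_apply, map_sub, map_smul, LinearMap.sub_apply, LinearMap.smul_apply,
    smul_eq_mul]
  rw [hsymm.eq v y]
  field_simp
  ring

/-- The reflection along a non-isotropic vector, as an element of the orthogonal group. -/
def reflection (hsymm : B.IsSymm) {v : V} (hv : B v v ≠ 0) : orthogonalGroup B :=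
  ⟨LinearEquiv.ofInvolutive (reflectionMap B v) (reflectionMap_involutive hv),
    apply_reflectionMap hsymm hv⟩

theorem reflection_inv_apply (hsymm : B.IsSymm) {v : V} (hv : B v v ≠ 0) (x : V) :
    (reflection hsymm hv : V ≃ₗ[ℝ] V)⁻¹ x = x - (2 / B v v * B x v) • v :=
  reflectionMap_apply v x

variable {ι : Type*} {b : Module.Basis ι ℝ V}

/-- The effect of a rotation in the plane of two basis vectors on the dual basis. -/
theorem coord_comp_rotation [DecidableEq ι] {f : V →ₗ[ℝ] V} {α β γ δ : ℝ} {p q : ι} (hpq : p ≠ q)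
    (hp : f (b p) = α • b p + β • b q) (hq : f (b q) = γ • b p + δ • b q)
    (hf : ∀ i, i ≠ p → i ≠ q → f (b i) = b i) :
    b.coord p ∘ₗ f = α • b.coord p + γ • b.coord q ∧
    b.coord q ∘ₗ f = β • b.coord p + δ • b.coord q ∧
    ∀ i, i ≠ p → i ≠ q → b.coord i ∘ₗ f = b.coord i := by
  refine ⟨b.ext fun j => ?_, b.ext fun j => ?_, fun i hip hiq => b.ext fun j => ?_⟩ <;>
  · rcases eq_or_ne j p with rfl | hjp
    · simp_all
    · rcases eq_or_ne j q with rfl | hjq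
      · simp_all
      · simp_all [Finsupp.single_apply]

theorem coord_comp_flip [DecidableEq ι] {f : V →ₗ[ℝ] V} {p : ι} (hp : f (b p) = -b p)
    (hf : ∀ i, i ≠ p → f (b i) = b i) :
    b.coord p ∘ₗ f = -b.coord p ∧ ∀ i, i ≠ p → b.coord i ∘ₗ f = b.coord i := by
  refine ⟨b.ext fun j => ?_, fun i hip => b.ext fun j => ?_⟩ <;>
  · rcases eq_or_ne j p with rfl | hjp
    · simp_all
    · simp_all [Finsupp.single_apply]

variable [Fintype ι]

theorem exists_flip (hsymm : B.IsSymm) (hB : B.Nondegenerate)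
    (hb : ∀ i j, i ≠ j → B (b i) (b j) = 0) (p : ι) :
    ∃ g : orthogonalGroup B, (g : V ≃ₗ[ℝ] V)⁻¹ (b p) = -b p ∧
      ∀ i, i ≠ p → (g : V ≃ₗ[ℝ] V)⁻¹ (b i) = b i := by
  have hp := orthogonal_basis_apply_self_ne_zero hB hb p
  refine ⟨reflection hsymm hp, ?_, fun i hi => ?_⟩
  · rw [reflection_inv_apply, div_mul_cancel₀ _ hp, two_smul]
    abel
  · rw [reflection_inv_apply, hb i p hi]
    simp

/-- The isometry is the reflection along b p + c b q for a suitable c. The last relation says that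
the images of b p and b q are still orthogonal; it is what later turns αγ X + βδ Y = 0 into X / B(b
p, b p) = Y / B(b q, b q). -/
theorem exists_rotation (hsymm : B.IsSymm) (hB : B.Nondegenerate)
    (hb : ∀ i j, i ≠ j → B (b i) (b j) = 0) {p q : ι} (hpq : p ≠ q) :
    ∃ (g : orthogonalGroup B) (α β γ δ : ℝ), α ≠ 0 ∧ β ≠ 0 ∧ γ ≠ 0 ∧ δ ≠ 0 ∧
      (g : V ≃ₗ[ℝ] V)⁻¹ (b p) = α • b p + β • b q ∧
      (g : V ≃ₗ[ℝ] V)⁻¹ (b q) = γ • b p + δ • b q ∧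
      (∀ i, i ≠ p → i ≠ q → (g : V ≃ₗ[ℝ] V)⁻¹ (b i) = b i) ∧
      α * γ * B (b p) (b p) + β * δ * B (b q) (b q) = 0 := by
  have hp := orthogonal_basis_apply_self_ne_zero hB hb p
  have hq := orthogonal_basis_apply_self_ne_zero hB hb q
  set x := B (b p) (b p) with hx
  set y := B (b q) (b q) with hy
  -- The first inequality makes the reflecting vector non-isotropic, the second makes the diagonal
  -- coefficients nonzero. If c = 1 fails then x = ±y, and c = 2 works because y ≠ 0.
  obtain ⟨c, hc, hc1, hc2⟩ : ∃ c : ℝ, c ≠ 0 ∧ x + c ^ 2 * y ≠ 0 ∧ x - c ^ 2 * y ≠ 0 := by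
    by_cases h : x + y ≠ 0 ∧ x - y ≠ 0
    · exact ⟨1, one_ne_zero, by simpa using h.1, by simpa using h.2⟩
    · refine ⟨2, two_ne_zero, fun h1 => h ⟨fun h2 => hq ?_, fun h2 => hq ?_⟩,
        fun h1 => h ⟨fun h2 => hq ?_, fun h2 => hq ?_⟩⟩ <;> linarith
  have e1 : B (b p) (b p + c • b q) = x := by simp [hb p q hpq, hx]
  have e2 : B (b q) (b p + c • b q) = c * y := by simp [hb q p hpq.symm, hy]
  have e : B (b p + c • b q) (b p + c • b q) = x + c ^ 2 * y := by
    rw [map_add, map_smul, hsymm.eq _ (b p), hsymm.eq _ (b q), e1, e2, smul_eq_mul]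
    ring
  have hv : B (b p + c • b q) (b p + c • b q) ≠ 0 := e ▸ hc1
  have hg := reflection_inv_apply hsymm hv
  refine ⟨reflection hsymm hv, -(x - c ^ 2 * y) / (x + c ^ 2 * y), -(2 * c * x) / (x + c ^ 2 * y),
    -(2 * c * y) / (x + c ^ 2 * y), (x - c ^ 2 * y) / (x + c ^ 2 * y), ?_, ?_, ?_, ?_, ?_, ?_, ?_,
    ?_⟩
  · exact div_ne_zero (neg_ne_zero.2 hc2) hc1
  · exact div_ne_zero (neg_ne_zero.2 (mul_ne_zero (mul_ne_zero two_ne_zero hc) hp)) hc1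
  · exact div_ne_zero (neg_ne_zero.2 (mul_ne_zero (mul_ne_zero two_ne_zero hc) hq)) hc1
  · exact div_ne_zero hc2 hc1
  · rw [hg, e, e1]
    match_scalars <;> field_simp <;> ring
  · rw [hg, e, e2]
    match_scalars <;> field_simp <;> ring
  · intro i hip hiq
    rw [hg]
    simp [hb i p hip, hb i q hiq]
  · field_simp
    ring

end Reflection

/-! ### Invariant forms on tensors -/

section TraceForm

variable {V : Type*} [AddCommGroup V] [Module ℝ V] [FiniteDimensional ℝ V]
  {B : LinearMap.BilinForm ℝ V} {M : Type*} [AddCommGroup M] [Module ℝ M]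

/-- The contraction of two linear maps `V → M` with the metric on `V` and a form on `M`. -/
def traceForm (B : LinearMap.BilinForm ℝ V) (hB : B.Nondegenerate) (c : LinearMap.BilinForm ℝ M) :
    LinearMap.BilinForm ℝ (V →ₗ[ℝ] M) :=
  LinearMap.mk₂ ℝ (fun F G => metricTrace B hB (c.compl₁₂ F G))
    (fun F F' G => by rw [← map_add]; congr 1; ext; simp)
    (fun r F G => by rw [← map_smul]; congr 1; ext; simp)
    (fun F G G' => by rw [← map_add]; congr 1; ext; simp)
    (fun r F G => by rw [← map_smul]; congr 1; ext; simp)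

/-- Invariance of the form on M absorbs the action on values, and invariance of the trace absorbs
the action on V. Iterating this gives invariance on all tensor powers. -/
theorem traceForm_linHom (hB : B.Nondegenerate) {c : LinearMap.BilinForm ℝ M}
    {σ : Representation ℝ (V ≃ₗ[ℝ] V) M} (g : orthogonalGroup B)
    (hc : ∀ x y, c (σ g x) (σ g y) = c x y) (F G : V →ₗ[ℝ] M) :
    traceForm B hB c ((stdRep V).linHom σ g F) ((stdRep V).linHom σ g G) = traceForm B hB c F G :=
  (congrArg (metricTrace B hB) (by ext x y; exact hc _ _)).trans
    (metricTrace_orep2 B hB g (c.compl₁₂ F G))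

theorem traceForm_eq_sum {ι : Type*} [Fintype ι] [DecidableEq ι] (hB : B.Nondegenerate)
    (hsymm : B.IsSymm) {b : Module.Basis ι ℝ V} (hb : ∀ i j, i ≠ j → B (b i) (b j) = 0)
    (c : LinearMap.BilinForm ℝ M) (F G : V →ₗ[ℝ] M) :
    traceForm B hB c F G = ∑ i, (B (b i) (b i))⁻¹ * c (F (b i)) (G (b i)) :=
  metricTrace_eq_sum_orthogonal hB hsymm hb (c.compl₁₂ F G)

/-- The form on `⊗²V*` induced by the metric. -/
def form2 (B : LinearMap.BilinForm ℝ V) (hB : B.Nondegenerate) :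
    LinearMap.BilinForm ℝ (Tensor2 V) :=
  traceForm B hB (traceForm B hB (LinearMap.mul ℝ ℝ))

/-- The form on `⊗⁴V*` induced by the metric. -/
def form4 (B : LinearMap.BilinForm ℝ V) (hB : B.Nondegenerate) :
    LinearMap.BilinForm ℝ (Tensor4 V) :=
  traceForm B hB (traceForm B hB (form2 B hB))

theorem form2_orep2 (hB : B.Nondegenerate) (g : orthogonalGroup B) (φ ψ : Tensor2 V) :
    form2 B hB (orep2 B g φ) (orep2 B g ψ) = form2 B hB φ ψ :=
  traceForm_linHom hB g (fun f h => traceForm_linHom hB g (fun _ _ => rfl) f h) φ ψ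

theorem form4_orep4 (hB : B.Nondegenerate) (g : orthogonalGroup B) (R S : Tensor4 V) :
    form4 B hB (orep4 B g R) (orep4 B g S) = form4 B hB R S :=
  traceForm_linHom hB g
    (fun F G => traceForm_linHom hB g (fun φ ψ => form2_orep2 hB g φ ψ) F G) R S

end TraceForm

theorem sum_mul_self_ne_zero {n : Type*} [Fintype n] (f : n → ℝ) {i : n} (h : f i ≠ 0) :
    ∑ j, f j * f j ≠ 0 := fun h0 =>
  h (mul_self_eq_zero.1 ((Finset.sum_eq_zero_iff_of_nonneg fun j _ => mul_self_nonneg (f j)).1 h0 i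
    (Finset.mem_univ i)))

/-! ### Irreducibility of the trace-free symmetric forms -/

section SymmetricForms

variable {V : Type*} [AddCommGroup V] [Module ℝ V]

/-- The symmetric product of two linear forms. -/
def symProd (f h : V →ₗ[ℝ] ℝ) : Tensor2 V := f.smulRight h + h.smulRight f

theorem symProd_apply (f h : V →ₗ[ℝ] ℝ) (x y : V) : symProd f h x y = f x * h y + h x * f y := rfl

theorem symProd_mem_sym2 (f h : V →ₗ[ℝ] ℝ) : symProd f h ∈ (sym2 V).toSubmodule := fun x y => by
  simp only [symProd_apply]
  ring

theorem symProd_comm (f h : V →ₗ[ℝ] ℝ) : symProd f h = symProd h f := by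
  ext x y
  simp only [symProd_apply]
  ring

variable {B : LinearMap.BilinForm ℝ V}

theorem orep2_symProd (g : orthogonalGroup B) (f h : V →ₗ[ℝ] ℝ) :
    orep2 B g (symProd f h) = symProd (f ∘ₗ ((g : V ≃ₗ[ℝ] V)⁻¹ : V ≃ₗ[ℝ] V).toLinearMap)
      (h ∘ₗ ((g : V ≃ₗ[ℝ] V)⁻¹ : V ≃ₗ[ℝ] V).toLinearMap) := rfl

variable {ι : Type*} [Fintype ι] [DecidableEq ι] {b : Module.Basis ι ℝ V}
  {N : Submodule ℝ (Tensor2 V)}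

/-- Mixing q and r sends the given product to α times itself plus γ times the wanted one, with γ ≠
0. -/
theorem symProd_mem_of_symProd_mem (hsymm : B.IsSymm) (hB : B.Nondegenerate)
    (hb : ∀ i j, i ≠ j → B (b i) (b j) = 0) (hG : ∀ g, ∀ ψ ∈ N, orep2 B g ψ ∈ N) {p q r : ι}
    (hpq : p ≠ q) (hpr : p ≠ r) (h : symProd (b.coord p) (b.coord q) ∈ N) :
    symProd (b.coord p) (b.coord r) ∈ N := by
  rcases eq_or_ne q r with rfl | hqr
  · exact h
  obtain ⟨g, α, β, γ, δ, -, -, hγ, -, hgq, hgr, hg, -⟩ := exists_rotation hsymm hB hb hqr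
  obtain ⟨hcq, -, hc⟩ := coord_comp_rotation
    (f := ((g : V ≃ₗ[ℝ] V)⁻¹ : V ≃ₗ[ℝ] V).toLinearMap) hqr hgq hgr hg
  have h1 := hG g _ h
  rw [orep2_symProd, hcq, hc p hpq hpr] at h1
  have h2 : symProd (b.coord p) (α • b.coord q + γ • b.coord r) =
      α • symProd (b.coord p) (b.coord q) + γ • symProd (b.coord p) (b.coord r) := by
    ext x y
    simp only [symProd_apply, LinearMap.add_apply, LinearMap.smul_apply, smul_eq_mul]
    ring
  rw [h2] at h1
  exact (N.smul_mem_iff hγ).1 ((N.add_mem_iff_right (N.smul_mem α h)).1 h1)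

variable [FiniteDimensional ℝ V] {hB : B.Nondegenerate}

/-- A form that stays diagonal after mixing any two basis vectors has all ratios ψ(b p, b p) / B(b
p, b p) equal. It is then a multiple of B, and a trace-free multiple of B is zero. -/
theorem exists_component_ne_zero_of_le_sym2Zero (hm : 4 ≤ Module.finrank ℝ V) (hsymm : B.IsSymm)
    (hb : ∀ i j, i ≠ j → B (b i) (b j) = 0) (hN : N ≤ (sym2Zero B hB).toSubmodule)
    (hG : ∀ g, ∀ ψ ∈ N, orep2 B g ψ ∈ N) (h0 : N ≠ ⊥) :
    ∃ ψ ∈ N, ∃ p q, p ≠ q ∧ ψ (b p) (b q) ≠ 0 := by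
  by_contra! H
  refine h0 ((Submodule.eq_bot_iff _).2 fun ψ hψ => ?_)
  have hw := orthogonal_basis_apply_self_ne_zero hB hb
  have h1 : ∀ p q, p ≠ q →
      (B (b p) (b p))⁻¹ * ψ (b p) (b p) = (B (b q) (b q))⁻¹ * ψ (b q) (b q) := fun p q hpq => by
    obtain ⟨g, α, β, γ, δ, hα, -, hγ, -, hgp, hgq, -, hrel⟩ := exists_rotation hsymm hB hb hpq
    have h := H _ (hG g ψ hψ) p q hpq
    change ψ ((g : V ≃ₗ[ℝ] V)⁻¹ (b p)) ((g : V ≃ₗ[ℝ] V)⁻¹ (b q)) = 0 at h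
    rw [hgp, hgq] at h
    simp only [map_add, map_smul, LinearMap.add_apply, LinearMap.smul_apply, smul_eq_mul,
      H ψ hψ p q hpq, H ψ hψ q p hpq.symm] at h
    have hp := hw p
    have hq := hw q
    have hαγ := mul_ne_zero hα hγ
    field_simp
    apply mul_left_cancel₀ hαγ
    linear_combination B (b q) (b q) * h - ψ (b q) (b q) * hrel
  have htr : metricTrace B hB ψ = 0 := (hN hψ).1
  rw [metricTrace_eq_sum_orthogonal hB hsymm hb] at htr
  have hd : ∀ p, ψ (b p) (b p) = 0 := fun p => by
    rw [Finset.sum_congr rfl fun q _ => (show _ = (B (b p) (b p))⁻¹ * ψ (b p) (b p) by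
      rcases eq_or_ne q p with rfl | hqp
      · rfl
      · exact h1 q p hqp), Finset.sum_const, Finset.card_univ, nsmul_eq_mul,
      ← Module.finrank_eq_card_basis b] at htr
    have hm' : (Module.finrank ℝ V : ℝ) ≠ 0 := by
      have : (4 : ℝ) ≤ Module.finrank ℝ V := by exact_mod_cast hm
      linarith
    exact (mul_eq_zero.1 ((mul_eq_zero.1 htr).resolve_left hm')).resolve_left
      (inv_ne_zero (hw p))
  refine b.ext fun p => b.ext fun q => ?_
  rcases eq_or_ne p q with rfl | hpq
  · exact hd p
  · exact H ψ hψ p q hpq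

theorem symProd_mem_of_component_ne_zero (hsymm : B.IsSymm)
    (hb : ∀ i j, i ≠ j → B (b i) (b j) = 0) (hN : N ≤ (sym2Zero B hB).toSubmodule)
    (hG : ∀ g, ∀ ψ ∈ N, orep2 B g ψ ∈ N) {ψ : Tensor2 V} (hψ : ψ ∈ N) {p q : ι} (hpq : p ≠ q)
    (h : ψ (b p) (b q) ≠ 0) : symProd (b.coord p) (b.coord q) ∈ N := by
  -- Half the difference of φ and its flip at r keeps just the components in which r occurs once.
  -- Doing this for p and for q leaves only the components (p, q) and (q, p).
  have odd : ∀ φ ∈ N, ∀ r, ∃ χ ∈ N, ∀ i j, χ (b i) (b j) =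
      1 / 2 * (1 - (if i = r then -1 else 1) * (if j = r then -1 else 1)) * φ (b i) (b j) := by
    intro φ hφ r
    obtain ⟨g, hr, hg⟩ := exists_flip hsymm hB hb r
    have hg' : ∀ i, (g : V ≃ₗ[ℝ] V)⁻¹ (b i) = (if i = r then -1 else 1 : ℝ) • b i := fun i => by
      split_ifs with hi
      · rw [hi, hr]; simp
      · rw [hg i hi]; simp
    refine ⟨(1 / 2 : ℝ) • (φ - orep2 B g φ), N.smul_mem _ (N.sub_mem hφ (hG g φ hφ)),
      fun i j => ?_⟩
    change (1 / 2 : ℝ) * (φ (b i) (b j) -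
      φ ((g : V ≃ₗ[ℝ] V)⁻¹ (b i)) ((g : V ≃ₗ[ℝ] V)⁻¹ (b j))) = _
    rw [hg' i, hg' j]
    simp only [map_smul, LinearMap.smul_apply, smul_eq_mul]
    ring
  obtain ⟨φ, hφ, hφ'⟩ := odd ψ hψ p
  obtain ⟨χ, hχ, hχ'⟩ := odd φ hφ q
  have hs : ψ (b q) (b p) = ψ (b p) (b q) := (hN hψ).2 _ _
  have : χ = ψ (b p) (b q) • symProd (b.coord p) (b.coord q) := by
    refine b.ext fun i => b.ext fun j => ?_
    rw [hχ', hφ', LinearMap.smul_apply, LinearMap.smul_apply, symProd_apply]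
    by_cases hip : i = p <;> by_cases hjp : j = p <;> by_cases hiq : i = q <;>
      by_cases hjq : j = q <;> simp_all <;> norm_num
  rw [this] at hχ
  exact (N.smul_mem_iff h).1 hχ

theorem isIrreducible_sym2Zero (hm : 4 ≤ Module.finrank ℝ V) (hsymm : B.IsSymm)
    (hB : B.Nondegenerate) : (sym2Zero B hB).toRepresentation.IsIrreducible := by
  obtain ⟨b, hb⟩ := exists_orthogonal_basis hsymm
  have hw := orthogonal_basis_apply_self_ne_zero hB hb
  let p : Fin (Module.finrank ℝ V) := ⟨0, by omega⟩
  let q : Fin (Module.finrank ℝ V) := ⟨1, by omega⟩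
  have hpq : p ≠ q := by simp [p, q]
  refine isIrreducible_of_forall_mem (sym2Zero B hB) (form2 B hB) (form2_orep2 hB)
    (symProd (b.coord p) (b.coord q)) ?_ ⟨?_, symProd_mem_sym2 _ _⟩ fun N hN hG h0 => ?_
  · rw [form2, traceForm_eq_sum hB hsymm hb]
    simp only [traceForm_eq_sum hB hsymm hb]
    set s := symProd (b.coord p) (b.coord q) with hs
    -- Wherever the component of s is nonzero, {i, j} = {p, q}, so the weight is constant there.
    -- What remains is a sum of squares, whatever the signature.
    have e : ∀ i j, (B (b i) (b i))⁻¹ * ((B (b j) (b j))⁻¹ *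
        LinearMap.mul ℝ ℝ (s (b i) (b j)) (s (b i) (b j))) =
        (B (b p) (b p))⁻¹ * (B (b q) (b q))⁻¹ * (s (b i) (b j) * s (b i) (b j)) := fun i j => by
      simp only [hs, symProd_apply, Module.Basis.coord_apply, Module.Basis.repr_self,
        Finsupp.single_apply, LinearMap.mul_apply_apply]
      by_cases hip : i = p <;> by_cases hjp : j = p <;> by_cases hiq : i = q <;>
        by_cases hjq : j = q <;> simp_all [mul_comm]
    simp only [Finset.mul_sum, e]
    simp only [← Finset.mul_sum]
    refine mul_ne_zero (mul_ne_zero (inv_ne_zero (hw p)) (inv_ne_zero (hw q))) ?_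
    rw [← Fintype.sum_prod_type']
    refine sum_mul_self_ne_zero (fun x : _ × _ => s (b x.1) (b x.2)) (i := (p, q)) ?_
    simp [hs, symProd_apply, hpq]
  · change metricTrace B hB _ = 0
    rw [metricTrace_eq_sum_orthogonal hB hsymm hb]
    refine Finset.sum_eq_zero fun i _ => ?_
    have : ¬ (i = p ∧ i = q) := fun h => hpq (h.1.symm.trans h.2)
    simp only [symProd_apply, Module.Basis.coord_apply, Module.Basis.repr_self,
      Finsupp.single_apply]
    split_ifs <;> simp_all
  · obtain ⟨ψ, hψ, i, j, hij, h⟩ :=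
      exists_component_ne_zero_of_le_sym2Zero hm hsymm hb hN hG h0
    have h1 := symProd_mem_of_component_ne_zero hsymm hb hN hG hψ hij h
    have key : ∀ i j k l, i ≠ j → k ≠ l → symProd (b.coord i) (b.coord j) ∈ N →
        symProd (b.coord k) (b.coord l) ∈ N := by
      intro i j k l hij hkl h
      rcases eq_or_ne i k with rfl | hik
      · exact symProd_mem_of_symProd_mem hsymm hB hb hG hij hkl h
      · have h2 := symProd_mem_of_symProd_mem hsymm hB hb hG hij hik h
        rw [symProd_comm] at h2
        exact symProd_mem_of_symProd_mem hsymm hB hb hG hik.symm hkl h2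
    exact key _ _ _ _ hij hpq h1

end SymmetricForms

/-! ### Irreducibility of the Weyl tensors -/

section Weyl

variable {V : Type*} [AddCommGroup V] [Module ℝ V]

theorem orep4_apply {B : LinearMap.BilinForm ℝ V} (g : orthogonalGroup B) (R : Tensor4 V)
    (x y z w : V) : orep4 B g R x y z w = R ((g : V ≃ₗ[ℝ] V)⁻¹ x) ((g : V ≃ₗ[ℝ] V)⁻¹ y)
      ((g : V ≃ₗ[ℝ] V)⁻¹ z) ((g : V ≃ₗ[ℝ] V)⁻¹ w) := rfl

/-- The product of two symmetric products of linear forms. -/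
def wedgeSym (f₁ f₂ f₃ f₄ : V →ₗ[ℝ] ℝ) : Tensor4 V := wedge (symProd f₁ f₂) (symProd f₃ f₄)

theorem wedgeSym_apply (f₁ f₂ f₃ f₄ : V →ₗ[ℝ] ℝ) (x y z w : V) :
    wedgeSym f₁ f₂ f₃ f₄ x y z w = (1 / 2 : ℝ) *
      ((f₁ x * f₂ w + f₂ x * f₁ w) * (f₃ y * f₄ z + f₄ y * f₃ z)
      - (f₁ x * f₂ z + f₂ x * f₁ z) * (f₃ y * f₄ w + f₄ y * f₃ w)
      + (f₁ y * f₂ z + f₂ y * f₁ z) * (f₃ x * f₄ w + f₄ x * f₃ w)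
      - (f₁ y * f₂ w + f₂ y * f₁ w) * (f₃ x * f₄ z + f₄ x * f₃ z)) := rfl

theorem wedgeSym_mem_algCurv (f₁ f₂ f₃ f₄ : V →ₗ[ℝ] ℝ) :
    wedgeSym f₁ f₂ f₃ f₄ ∈ (algCurv V).toSubmodule :=
  wedge_mem_algCurv (symProd_mem_sym2 _ _) (symProd_mem_sym2 _ _)

theorem wedgeSym_comm_left (f₁ f₂ f₃ f₄ : V →ₗ[ℝ] ℝ) :
    wedgeSym f₁ f₂ f₃ f₄ = wedgeSym f₂ f₁ f₃ f₄ := by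
  rw [wedgeSym, symProd_comm, wedgeSym]

theorem wedgeSym_comm_right (f₁ f₂ f₃ f₄ : V →ₗ[ℝ] ℝ) :
    wedgeSym f₁ f₂ f₃ f₄ = wedgeSym f₁ f₂ f₄ f₃ := by
  rw [wedgeSym, symProd_comm f₃, wedgeSym]

theorem orep4_wedgeSym {B : LinearMap.BilinForm ℝ V} (g : orthogonalGroup B)
    (f₁ f₂ f₃ f₄ : V →ₗ[ℝ] ℝ) :
    orep4 B g (wedgeSym f₁ f₂ f₃ f₄) =
      wedgeSym (f₁ ∘ₗ ((g : V ≃ₗ[ℝ] V)⁻¹ : V ≃ₗ[ℝ] V).toLinearMap)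
        (f₂ ∘ₗ ((g : V ≃ₗ[ℝ] V)⁻¹ : V ≃ₗ[ℝ] V).toLinearMap)
        (f₃ ∘ₗ ((g : V ≃ₗ[ℝ] V)⁻¹ : V ≃ₗ[ℝ] V).toLinearMap)
        (f₄ ∘ₗ ((g : V ≃ₗ[ℝ] V)⁻¹ : V ≃ₗ[ℝ] V).toLinearMap) := rfl

/-- All components of `R` vanish except those in which each of `a`, `b`, `c`, `d` occurs as an
index. -/
def SupportedOn {ι : Type*} (e : Module.Basis ι ℝ V) (a b c d : ι) (R : Tensor4 V) : Prop :=
  ∀ i j k l, R (e i) (e j) (e k) (e l) ≠ 0 → (a = i ∨ a = j ∨ a = k ∨ a = l) ∧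
    (b = i ∨ b = j ∨ b = k ∨ b = l) ∧ (c = i ∨ c = j ∨ c = k ∨ c = l) ∧
    (d = i ∨ d = j ∨ d = k ∨ d = l)

variable {ι : Type*} {e : Module.Basis ι ℝ V} {a b c d : ι}

theorem SupportedOn.add {R S : Tensor4 V} (hR : SupportedOn e a b c d R)
    (hS : SupportedOn e a b c d S) : SupportedOn e a b c d (R + S) := fun i j k l h => by
  by_cases h' : R (e i) (e j) (e k) (e l) = 0
  · refine hS i j k l fun h'' => h ?_
    simp [h', h'']
  · exact hR i j k l h'

theorem SupportedOn.smul {R : Tensor4 V} (hR : SupportedOn e a b c d R) (r : ℝ) :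
    SupportedOn e a b c d (r • R) := fun i j k l h =>
  hR i j k l fun h' => h (by simp [h'])

/-- Four distinct indices fill the four slots, each once. The curvature symmetries move a to the
first slot and fix the order of the last pair, which leaves the three listed components. -/
theorem SupportedOn.eq_zero {R : Tensor4 V} (hR : SupportedOn e a b c d R)
    (hA : R ∈ (algCurv V).toSubmodule) (hab : a ≠ b) (hac : a ≠ c) (had : a ≠ d) (hbc : b ≠ c)
    (hbd : b ≠ d) (hcd : c ≠ d) (h1 : R (e a) (e b) (e c) (e d) = 0)
    (h2 : R (e a) (e c) (e d) (e b) = 0) (h3 : R (e a) (e d) (e b) (e c) = 0) : R = 0 := by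
  obtain ⟨ha, -, hp, hl⟩ := hA
  have h1' : R (e a) (e b) (e d) (e c) = 0 := by rw [hl, h1, neg_zero]
  have h2' : R (e a) (e c) (e b) (e d) = 0 := by rw [hl, h2, neg_zero]
  have h3' : R (e a) (e d) (e c) (e b) = 0 := by rw [hl, h3, neg_zero]
  have key : ∀ j k l, R (e a) (e j) (e k) (e l) = 0 := by
    intro j k l
    by_contra h
    obtain ⟨-, hb, hc, hd⟩ := hR _ _ _ _ h
    have hb := hb.resolve_left hab.symm
    have hc := hc.resolve_left hac.symm
    have hd := hd.resolve_left had.symm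
    rcases hb with rfl | rfl | rfl <;> rcases hc with rfl | rfl | rfl <;>
      first
        | exact hbc rfl
        | (rcases hd with rfl | rfl | rfl <;> first
            | exact hbd rfl
            | exact hcd rfl
            | exact h h1
            | exact h h2
            | exact h h3
            | exact h h1'
            | exact h h2'
            | exact h h3')
  refine e.ext fun i => e.ext fun j => e.ext fun k => e.ext fun l => ?_
  by_contra h
  rcases (hR _ _ _ _ h).1 with rfl | rfl | rfl | rfl
  · exact h (key _ _ _)
  · exact h ((ha _ _ _ _).trans (by rw [key, neg_zero]; rfl))
  · exact h ((hp _ _ _ _).trans (key _ _ _))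
  · exact h ((hp _ _ _ _).trans ((ha _ _ _ _).trans (by rw [key, neg_zero]; rfl)))

theorem SupportedOn.wedgeSym : SupportedOn e a b c d
    (wedgeSym (e.coord a) (e.coord b) (e.coord c) (e.coord d)) := by
  classical
  intro i j k l h
  rw [wedgeSym_apply] at h
  simp only [Module.Basis.coord_apply, Module.Basis.repr_self, Finsupp.single_apply] at h
  refine ⟨?_, ?_, ?_, ?_⟩ <;>
  · by_contra! hn
    obtain ⟨n1, n2, n3, n4⟩ := hn
    simp [n1.symm, n2.symm, n3.symm, n4.symm] at h

theorem wedgeSym_coord_apply [DecidableEq ι] (hab : a ≠ b) (hac : a ≠ c) (had : a ≠ d)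
    (hbc : b ≠ c) (hbd : b ≠ d) (hcd : c ≠ d) :
    wedgeSym (e.coord a) (e.coord b) (e.coord c) (e.coord d) (e a) (e b) (e c) (e d) = 0 ∧
    wedgeSym (e.coord a) (e.coord b) (e.coord c) (e.coord d) (e a) (e c) (e d) (e b) = 1 / 2 ∧
    wedgeSym (e.coord a) (e.coord b) (e.coord c) (e.coord d) (e a) (e d) (e b) (e c) =
      -(1 / 2) := by
  simp only [wedgeSym_apply, Module.Basis.coord_apply, Module.Basis.repr_self,
    Finsupp.single_apply]
  simp [hab, hac, had, hbc, hbd, hcd, hab.symm, hac.symm, had.symm, hbc.symm, hbd.symm, hcd.symm]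

/-- A property of quadruples of distinct indices that is stable under exchanges of neighbours and
under replacement of the last index holds for all such quadruples if it holds for one. -/
theorem forall_distinct_of_moves {P : ι → ι → ι → ι → Prop}
    (h12 : ∀ a b c d, P a b c d → P b a c d) (h34 : ∀ a b c d, P a b c d → P a b d c)
    (h23 : ∀ a b c d, a ≠ b → a ≠ c → a ≠ d → b ≠ c → b ≠ d → c ≠ d → P a b c d → P a c b d)
    (hr : ∀ a b c d n, a ≠ d → b ≠ d → c ≠ d → a ≠ n → b ≠ n → c ≠ n → P a b c d → P a b c n)
    {a b c d : ι} (hab : a ≠ b) (hac : a ≠ c) (had : a ≠ d) (hbc : b ≠ c)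
    (hbd : b ≠ d) (hcd : c ≠ d) (h : P a b c d) {a' b' c' d' : ι} (hab' : a' ≠ b') (hac' : a' ≠ c')
    (had' : a' ≠ d') (hbc' : b' ≠ c') (hbd' : b' ≠ d') (hcd' : c' ≠ d') : P a' b' c' d' := by
  -- The slots are filled from first to last. A missing index enters through the last slot and is
  -- moved left by exchanges, leaving the slots already filled in place.
  have third : ∀ a b c d n, a ≠ b → a ≠ c → a ≠ d → b ≠ c → b ≠ d → c ≠ d → a ≠ n → b ≠ n →
      P a b c d → ∃ m, a ≠ m ∧ b ≠ m ∧ n ≠ m ∧ P a b n m := by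
    intro a b c d n hab hac had hbc hbd hcd han hbn h
    by_cases hcn : c = n
    · exact hcn ▸ ⟨d, had, hbd, hcd, h⟩
    · exact ⟨c, hac, hbc, fun h => hcn h.symm,
        h34 _ _ _ _ (hr a b c d n had hbd hcd han hbn hcn h)⟩
  have second : ∀ a b c d n, a ≠ b → a ≠ c → a ≠ d → b ≠ c → b ≠ d → c ≠ d → a ≠ n →
      P a b c d → ∃ m k, a ≠ m ∧ a ≠ k ∧ n ≠ m ∧ n ≠ k ∧ m ≠ k ∧ P a n m k := by
    intro a b c d n hab hac had hbc hbd hcd han h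
    by_cases hbn : b = n
    · exact hbn ▸ ⟨c, d, hac, had, hbc, hbd, hcd, h⟩
    · obtain ⟨m, h1, h2, h3, h4⟩ := third a b c d n hab hac had hbc hbd hcd han hbn h
      exact ⟨b, m, hab, h1, fun h => hbn h.symm, h3, h2, h23 _ _ _ _ hab han h1 hbn h2 h3 h4⟩
  obtain ⟨x, y, z, hx, hy, hz, hxy, hxz, hyz, h1⟩ : ∃ x y z, a' ≠ x ∧ a' ≠ y ∧ a' ≠ z ∧ x ≠ y ∧
      x ≠ z ∧ y ≠ z ∧ P a' x y z := by
    by_cases haa : a = a'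
    · exact haa ▸ ⟨b, c, d, hab, hac, had, hbc, hbd, hcd, h⟩
    · obtain ⟨m, k, h1, h2, h3, h4, h5, h6⟩ := second a b c d a' hab hac had hbc hbd hcd haa h
      exact ⟨a, m, k, fun h => haa h.symm, h3, h4, h1, h2, h5, h12 _ _ _ _ h6⟩
  obtain ⟨y, z, hy, hz, hby, hbz, hyz, h2⟩ := second a' x y z b' hx hy hz hxy hxz hyz hab' h1
  obtain ⟨z, hz, hbz, hcz, h3⟩ := third a' b' y z c' hab' hy hz hby hbz hyz hac' hbc' h2
  exact hr _ _ _ _ _ hz hbz hcz had' hbd' hcd' h3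

variable {B : LinearMap.BilinForm ℝ V} [Fintype ι] [DecidableEq ι] {N : Submodule ℝ (Tensor4 V)}

theorem wedgeSym_mem_of_replace (hsymm : B.IsSymm) (hB : B.Nondegenerate)
    (he : ∀ i j, i ≠ j → B (e i) (e j) = 0) (hG : ∀ g, ∀ R ∈ N, orep4 B g R ∈ N) {n : ι}
    (had : a ≠ d) (hbd : b ≠ d) (hcd : c ≠ d) (han : a ≠ n) (hbn : b ≠ n) (hcn : c ≠ n)
    (h : wedgeSym (e.coord a) (e.coord b) (e.coord c) (e.coord d) ∈ N) :
    wedgeSym (e.coord a) (e.coord b) (e.coord c) (e.coord n) ∈ N := by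
  rcases eq_or_ne d n with rfl | hdn
  · exact h
  obtain ⟨g, α, β, γ, δ, -, -, hγ, -, hgd, hgn, hg, -⟩ := exists_rotation hsymm hB he hdn
  obtain ⟨hcod, -, hco⟩ := coord_comp_rotation
    (f := ((g : V ≃ₗ[ℝ] V)⁻¹ : V ≃ₗ[ℝ] V).toLinearMap) hdn hgd hgn hg
  have h1 := hG g _ h
  rw [orep4_wedgeSym, hcod, hco a had han, hco b hbd hbn, hco c hcd hcn] at h1
  have h2 : wedgeSym (e.coord a) (e.coord b) (e.coord c) (α • e.coord d + γ • e.coord n) =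
      α • wedgeSym (e.coord a) (e.coord b) (e.coord c) (e.coord d) +
        γ • wedgeSym (e.coord a) (e.coord b) (e.coord c) (e.coord n) := by
    refine Tensor4.ext4 fun x y z w => ?_
    simp only [wedgeSym_apply, LinearMap.add_apply, LinearMap.smul_apply, smul_eq_mul]
    ring
  rw [h2] at h1
  exact (N.smul_mem_iff hγ).1 ((N.add_mem_iff_right (N.smul_mem α h)).1 h1)

/-- Mixing b and c produces four terms, with middle factors bb, bc, cb and cc. Subtracting the flip
at b removes the bb and cc terms; the bc term is already in N, and the cb term has coefficient 2γβ ≠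
0. -/
theorem wedgeSym_mem_of_swap (hsymm : B.IsSymm) (hB : B.Nondegenerate)
    (he : ∀ i j, i ≠ j → B (e i) (e j) = 0) (hG : ∀ g, ∀ R ∈ N, orep4 B g R ∈ N)
    (hab : a ≠ b) (hac : a ≠ c) (hbc : b ≠ c) (hbd : b ≠ d) (hcd : c ≠ d)
    (h : wedgeSym (e.coord a) (e.coord b) (e.coord c) (e.coord d) ∈ N) :
    wedgeSym (e.coord a) (e.coord c) (e.coord b) (e.coord d) ∈ N := by
  obtain ⟨g, α, β, γ, δ, -, hβ, hγ, -, hgb, hgc, hg, -⟩ := exists_rotation hsymm hB he hbc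
  obtain ⟨hcob, hcoc, hco⟩ := coord_comp_rotation
    (f := ((g : V ≃ₗ[ℝ] V)⁻¹ : V ≃ₗ[ℝ] V).toLinearMap) hbc hgb hgc hg
  obtain ⟨s, hsb, hs⟩ := exists_flip hsymm hB he b
  obtain ⟨hfb, hfo⟩ := coord_comp_flip
    (f := ((s : V ≃ₗ[ℝ] V)⁻¹ : V ≃ₗ[ℝ] V).toLinearMap) hsb hs
  have h1 := hG g _ h
  have h2 := hG s _ h1
  have e1 : orep4 B g (wedgeSym (e.coord a) (e.coord b) (e.coord c) (e.coord d)) =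
      (α * β) • wedgeSym (e.coord a) (e.coord b) (e.coord b) (e.coord d) +
      (α * δ) • wedgeSym (e.coord a) (e.coord b) (e.coord c) (e.coord d) +
      (γ * β) • wedgeSym (e.coord a) (e.coord c) (e.coord b) (e.coord d) +
      (γ * δ) • wedgeSym (e.coord a) (e.coord c) (e.coord c) (e.coord d) := by
    rw [orep4_wedgeSym, hcob, hcoc, hco a hab hac, hco d hbd.symm hcd.symm]
    refine Tensor4.ext4 fun x y z w => ?_
    simp only [wedgeSym_apply, LinearMap.add_apply, LinearMap.smul_apply, smul_eq_mul]
    ring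
  have e2 : orep4 B g (wedgeSym (e.coord a) (e.coord b) (e.coord c) (e.coord d)) -
      orep4 B s (orep4 B g (wedgeSym (e.coord a) (e.coord b) (e.coord c) (e.coord d))) =
      (2 * (α * δ)) • wedgeSym (e.coord a) (e.coord b) (e.coord c) (e.coord d) +
      (2 * (γ * β)) • wedgeSym (e.coord a) (e.coord c) (e.coord b) (e.coord d) := by
    rw [e1, map_add, map_add, map_add, map_smul, map_smul, map_smul, map_smul]
    simp only [orep4_wedgeSym]
    rw [hfb, hfo a hab, hfo c hbc.symm, hfo d hbd.symm]
    refine Tensor4.ext4 fun x y z w => ?_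
    simp only [wedgeSym_apply, LinearMap.add_apply, LinearMap.sub_apply, LinearMap.neg_apply,
      LinearMap.smul_apply, smul_eq_mul]
    ring
  have h3 := N.sub_mem h1 h2
  rw [e2] at h3
  exact (N.smul_mem_iff (mul_ne_zero two_ne_zero (mul_ne_zero hγ hβ))).1
    ((N.add_mem_iff_right (N.smul_mem _ h)).1 h3)

theorem exists_odd_part (hsymm : B.IsSymm) (hB : B.Nondegenerate)
    (he : ∀ i j, i ≠ j → B (e i) (e j) = 0) (hG : ∀ g, ∀ R ∈ N, orep4 B g R ∈ N)
    {R : Tensor4 V} (hR : R ∈ N) (p : ι) :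
    ∃ S ∈ N, ∀ i j k l, S (e i) (e j) (e k) (e l) =
      1 / 2 * (1 - (if i = p then -1 else 1) * (if j = p then -1 else 1) *
        (if k = p then -1 else 1) * (if l = p then -1 else 1)) *
        R (e i) (e j) (e k) (e l) := by
  obtain ⟨g, hp, hg⟩ := exists_flip hsymm hB he p
  have hg' : ∀ i, (g : V ≃ₗ[ℝ] V)⁻¹ (e i) = (if i = p then -1 else 1 : ℝ) • e i := fun i => by
    split_ifs with hi
    · rw [hi, hp, neg_one_smul]
    · rw [hg i hi, one_smul]
  refine ⟨(1 / 2 : ℝ) • (R - orep4 B g R), N.smul_mem _ (N.sub_mem hR (hG g R hR)),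
    fun i j k l => ?_⟩
  simp only [LinearMap.smul_apply, LinearMap.sub_apply, orep4_apply, smul_eq_mul]
  rw [hg' i, hg' j, hg' k, hg' l]
  simp only [map_smul, LinearMap.smul_apply, smul_eq_mul]
  ring

/-- Taking odd parts at a, b, c, d in turn keeps only the components in which each index occurs an
odd number of times, hence at least once. -/
theorem exists_supportedOn (hsymm : B.IsSymm) (hB : B.Nondegenerate)
    (he : ∀ i j, i ≠ j → B (e i) (e j) = 0) (hG : ∀ g, ∀ R ∈ N, orep4 B g R ∈ N)
    {R : Tensor4 V} (hR : R ∈ N) (hab : a ≠ b) (hac : a ≠ c) (had : a ≠ d) (hbc : b ≠ c)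
    (hbd : b ≠ d) (hcd : c ≠ d) :
    ∃ S ∈ N, SupportedOn e a b c d S ∧
      S (e a) (e b) (e c) (e d) = R (e a) (e b) (e c) (e d) ∧
      S (e a) (e c) (e d) (e b) = R (e a) (e c) (e d) (e b) ∧
      S (e a) (e d) (e b) (e c) = R (e a) (e d) (e b) (e c) := by
  obtain ⟨Sa, hSa, ha⟩ := exists_odd_part hsymm hB he hG hR a
  obtain ⟨Sb, hSb, hb⟩ := exists_odd_part hsymm hB he hG hSa b
  obtain ⟨Sc, hSc, hc⟩ := exists_odd_part hsymm hB he hG hSb c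
  obtain ⟨Sd, hSd, hd⟩ := exists_odd_part hsymm hB he hG hSc d
  refine ⟨Sd, hSd, fun i j k l h => ?_, ?_, ?_, ?_⟩
  · rw [hd, hc, hb, ha] at h
    refine ⟨?_, ?_, ?_, ?_⟩ <;>
    · by_contra! hn
      obtain ⟨n1, n2, n3, n4⟩ := hn
      simp [n1.symm, n2.symm, n3.symm, n4.symm] at h
  all_goals
    rw [hd, hc, hb, ha]
    simp only [hab, hac, had, hbc, hbd, hcd, hab.symm, hac.symm, had.symm, hbc.symm, hbd.symm,
      hcd.symm, if_true, if_false]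
    ring

theorem wedgeSym_mem_of_component_ne (hsymm : B.IsSymm) (hB : B.Nondegenerate)
    (he : ∀ i j, i ≠ j → B (e i) (e j) = 0) (hN : N ≤ (algCurv V).toSubmodule)
    (hG : ∀ g, ∀ R ∈ N, orep4 B g R ∈ N) {R : Tensor4 V} (hR : R ∈ N) (hab : a ≠ b) (hac : a ≠ c)
    (had : a ≠ d) (hbc : b ≠ c) (hbd : b ≠ d) (hcd : c ≠ d)
    (h : R (e a) (e c) (e d) (e b) ≠ R (e a) (e d) (e b) (e c)) :
    wedgeSym (e.coord a) (e.coord b) (e.coord c) (e.coord d) ∈ N := by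
  obtain ⟨S, hS, hSs, hS1, hS2, hS3⟩ :=
    exists_supportedOn hsymm hB he hG hR hab hac had hbc hbd hcd
  obtain ⟨g, α, β, γ, δ, -, hβ, hγ, -, hgc, hgd, hg, -⟩ := exists_rotation hsymm hB he hcd
  obtain ⟨T, hT, hTs, hT1, hT2, hT3⟩ :=
    exists_supportedOn hsymm hB he hG (hG g S hS) hab hac had hbc hbd hcd
  obtain ⟨w1, w2, w3⟩ := wedgeSym_coord_apply (e := e) hab hac had hbc hbd hcd
  have hSA := hN hS
  have z1 : S (e a) (e b) (e c) (e c) = 0 := by linarith [hSA.2.2.2 (e a) (e b) (e c) (e c)]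
  have z2 : S (e a) (e b) (e d) (e d) = 0 := by linarith [hSA.2.2.2 (e a) (e b) (e d) (e d)]
  have z3 : S (e a) (e c) (e c) (e b) = 0 := by
    by_contra hz
    rcases (hSs _ _ _ _ hz).2.2.2 with h | h | h | h
    exacts [had h.symm, hcd h.symm, hcd h.symm, hbd h.symm]
  have z4 : S (e a) (e d) (e d) (e b) = 0 := by
    by_contra hz
    rcases (hSs _ _ _ _ hz).2.2.1 with h | h | h | h
    exacts [hac h.symm, hcd h, hcd h, hbc h.symm]
  have z5 : S (e a) (e c) (e b) (e c) = 0 := by rw [hSA.2.2.2, z3, neg_zero]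
  have z6 : S (e a) (e d) (e b) (e d) = 0 := by rw [hSA.2.2.2, z4, neg_zero]
  have a1 := hSA.2.2.2 (e a) (e b) (e d) (e c)
  have a2 := hSA.2.2.2 (e a) (e d) (e c) (e b)
  have a3 := hSA.2.2.2 (e a) (e c) (e b) (e d)
  rw [orep4_apply, hg a hac had, hg b hbc hbd, hgc, hgd] at hT1 hT2 hT3
  simp only [map_add, map_smul, LinearMap.add_apply, LinearMap.smul_apply, smul_eq_mul, z1, z2, z3,
    z4, z5, z6, a1, a2, a3] at hT1 hT2 hT3
  set Y := S (e a) (e c) (e d) (e b)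
  set Z := S (e a) (e d) (e b) (e c)
  have hYZ : 2 * (β * γ * (Y - Z)) ≠ 0 :=
    mul_ne_zero two_ne_zero (mul_ne_zero (mul_ne_zero hβ hγ) (by rwa [hS2, hS3, sub_ne_zero]))
  set W := wedgeSym (e.coord a) (e.coord b) (e.coord c) (e.coord d)
  -- On the components abcd, acdb, adbc, T takes the values (αδ - βγ)X, αδY - βγZ, αδZ - βγY, where
  -- X, Y, Z are those of S. Adding (βγ - αδ)S leaves 0, βγ(Y - Z), -βγ(Y - Z), proportional to the
  -- values 0, ½, -½ of W.
  have h0 : T + (β * γ - α * δ) • S + (-(2 * (β * γ * (Y - Z)))) • W = 0 := by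
    refine SupportedOn.eq_zero ((hTs.add (hSs.smul _)).add (SupportedOn.wedgeSym.smul _))
      (Submodule.add_mem _ (Submodule.add_mem _ (hN hT) (Submodule.smul_mem _ _ hSA))
        (Submodule.smul_mem _ _ (wedgeSym_mem_algCurv _ _ _ _))) hab hac had hbc hbd hcd ?_ ?_ ?_
    all_goals
      simp only [LinearMap.add_apply, LinearMap.smul_apply, smul_eq_mul, w1, w2, w3, hT1,
        hT2, hT3]
      ring
  have h1 : (2 * (β * γ * (Y - Z))) • W = T + (β * γ - α * δ) • S := by
    rw [neg_smul, add_neg_eq_zero] at h0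
    exact h0.symm
  exact (N.smul_mem_iff hYZ).1 (h1 ▸ N.add_mem hT (N.smul_mem _ hS))

variable [FiniteDimensional ℝ V] {hB : B.Nondegenerate}

theorem sum_erase_erase_eq {f : ι → ℝ} {j k : ι} (hjk : j ≠ k) (x : ℝ) (hj : f j = 0)
    (hk : f k = 0) (h : ∀ i, i ≠ j → i ≠ k → f i = x) :
    ∑ i, f i = ((Fintype.card ι : ℝ) - 2) * x := by
  have : ∀ i, f i = x - (if i = j then x else 0) - (if i = k then x else 0) := fun i => by
    rcases eq_or_ne i j with rfl | hij
    · simp [hj, hjk]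
    · rcases eq_or_ne i k with rfl | hik
      · simp [hk, hij]
      · simp [hij, hik, h i hij hik]
  rw [Finset.sum_congr rfl fun i _ => this i]
  simp [Finset.sum_sub_distrib]
  ring

theorem sum_erase_eq {f : ι → ℝ} {j : ι} (x : ℝ) (hj : f j = 0) (h : ∀ i, i ≠ j → f i = x) :
    ∑ i, f i = ((Fintype.card ι : ℝ) - 1) * x := by
  have : ∀ i, f i = x - (if i = j then x else 0) := fun i => by
    rcases eq_or_ne i j with rfl | hij
    · simp [hj]
    · simp [hij, h i hij]
  rw [Finset.sum_congr rfl fun i _ => this i]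
  simp [Finset.sum_sub_distrib]
  ring

/-- Suppose that all components with distinct indices vanish on N. Mixing i and l shows that
R(i,j,k,i) / B(i,i) is independent of i, and ρ₁₄(R) = 0 becomes m - 2 times this ratio. So the
components with one repeated index vanish. The same argument, one level down and with factor m - 1,
kills R(i,j,j,i), and the symmetries cover the rest. -/
theorem exists_component_ne_zero_of_le_weyl (hm : 4 ≤ Module.finrank ℝ V) (hsymm : B.IsSymm)
    (he : ∀ i j, i ≠ j → B (e i) (e j) = 0) (hN : N ≤ (weyl B hB).toSubmodule)
    (hG : ∀ g, ∀ R ∈ N, orep4 B g R ∈ N) (h0 : N ≠ ⊥) :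
    ∃ R ∈ N, ∃ a b c d, a ≠ b ∧ a ≠ c ∧ a ≠ d ∧ b ≠ c ∧ b ≠ d ∧ c ≠ d ∧
      R (e a) (e b) (e c) (e d) ≠ 0 := by
  by_contra! H
  have hw := orthogonal_basis_apply_self_ne_zero hB he
  have hcard : (4 : ℝ) ≤ Fintype.card ι := by
    rw [← Module.finrank_eq_card_basis e]
    exact_mod_cast hm
  have z12 : ∀ R ∈ N, ∀ x y z, R x x y z = 0 := fun R hR x y z => by
    linarith [(hN hR).2.1 x x y z]
  have z34 : ∀ R ∈ N, ∀ x y z, R y z x x = 0 := fun R hR x y z => by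
    linarith [(hN hR).2.2.2.2 y z x x]
  have ric : ∀ R ∈ N, ∀ y z, ∑ i, (B (e i) (e i))⁻¹ * R (e i) y z (e i) = 0 := fun R hR y z => by
    rw [← rho14_eq_sum_orthogonal hB hsymm he, show rho14 B hB R = 0 from (hN hR).1]
    rfl
  have solve : ∀ {i l : ι} {α β γ δ x y : ℝ}, α ≠ 0 → γ ≠ 0 →
      α * γ * B (e i) (e i) + β * δ * B (e l) (e l) = 0 → α * γ * x + β * δ * y = 0 →
      (B (e i) (e i))⁻¹ * x = (B (e l) (e l))⁻¹ * y := by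
    intro i l α β γ δ x y hα hγ hrel h
    have hi := hw i
    have hl := hw l
    field_simp
    apply mul_left_cancel₀ (mul_ne_zero hα hγ)
    linear_combination B (e l) (e l) * h - y * hrel
  have offdiag : ∀ R ∈ N, ∀ i j k, i ≠ j → i ≠ k → j ≠ k →
      R (e i) (e j) (e k) (e i) = 0 := by
    intro R hR i j k hij hik hjk
    have h1 : ∀ l, l ≠ j → l ≠ k → (B (e l) (e l))⁻¹ * R (e l) (e j) (e k) (e l) =
        (B (e i) (e i))⁻¹ * R (e i) (e j) (e k) (e i) := by
      intro l hlj hlk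
      rcases eq_or_ne l i with rfl | hli
      · rfl
      obtain ⟨g, α, β, γ, δ, hα, -, hγ, -, hgl, hgi, hg, hrel⟩ := exists_rotation hsymm hB he hli
      have h := H _ (hG g R hR) l j k i hlj hlk hli hjk hij.symm hik.symm
      rw [orep4_apply, hgl, hgi, hg j hlj.symm hij.symm, hg k hlk.symm hik.symm] at h
      simp only [map_add, map_smul, LinearMap.add_apply, LinearMap.smul_apply, smul_eq_mul,
        H R hR l j k i hlj hlk hli hjk hij.symm hik.symm,
        H R hR i j k l hij hik hli.symm hjk hlj.symm hlk.symm] at h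
      exact solve hα hγ hrel (by linear_combination h)
    have h2 := ric R hR (e j) (e k)
    rw [sum_erase_erase_eq hjk _ (by rw [z12 R hR, mul_zero]) (by rw [z34 R hR, mul_zero]) h1] at h2
    exact ((mul_eq_zero.1 ((mul_eq_zero.1 h2).resolve_left (by linarith))).resolve_left
      (inv_ne_zero (hw i)))
  have diag : ∀ R ∈ N, ∀ i j, i ≠ j → R (e i) (e j) (e j) (e i) = 0 := by
    intro R hR i j hij
    have hs : ∀ k, R (e k) (e i) (e i) (e k) = R (e i) (e k) (e k) (e i) := fun k => by
      rw [(hN hR).2.1, (hN hR).2.2.2.2, neg_neg]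
    have h1 : ∀ k, k ≠ i → (B (e k) (e k))⁻¹ * R (e k) (e i) (e i) (e k) =
        (B (e j) (e j))⁻¹ * R (e i) (e j) (e j) (e i) := by
      intro k hki
      rw [hs]
      rcases eq_or_ne k j with rfl | hkj
      · rfl
      obtain ⟨g, α, β, γ, δ, hα, -, hγ, -, hgk, hgj, hg, hrel⟩ := exists_rotation hsymm hB he hkj
      have h := offdiag _ (hG g R hR) i k j hki.symm hij hkj
      rw [orep4_apply, hgk, hgj, hg i hki.symm hij] at h
      simp only [map_add, map_smul, LinearMap.add_apply, LinearMap.smul_apply, smul_eq_mul,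
        offdiag R hR i k j hki.symm hij hkj, offdiag R hR i j k hij hki.symm hkj.symm] at h
      exact solve hα hγ hrel (by linear_combination h)
    have h2 := ric R hR (e i) (e i)
    rw [sum_erase_eq _ (by rw [z12 R hR, mul_zero]) h1] at h2
    exact ((mul_eq_zero.1 ((mul_eq_zero.1 h2).resolve_left (by linarith))).resolve_left
      (inv_ne_zero (hw j)))
  refine h0 ((Submodule.eq_bot_iff _).2 fun R hR => e.ext fun i => e.ext fun j => e.ext fun k =>
    e.ext fun l => ?_)
  change R (e i) (e j) (e k) (e l) = 0
  have side : ∀ i j k, i ≠ j → i ≠ k → R (e i) (e j) (e k) (e i) = 0 := fun i j k hij hik => by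
    rcases eq_or_ne j k with rfl | hjk
    · exact diag R hR i j hij
    · exact offdiag R hR i j k hij hik hjk
  have hA := (hN hR).2
  rcases eq_or_ne i j with rfl | hij
  · exact z12 R hR _ _ _
  rcases eq_or_ne k l with rfl | hkl
  · exact z34 R hR _ _ _
  rcases eq_or_ne i l with rfl | hil
  · exact side i j k hij hkl.symm
  rcases eq_or_ne i k with rfl | hik
  · rw [hA.2.2.2, side i j l hij hil, neg_zero]
  rcases eq_or_ne j l with rfl | hjl
  · rw [hA.1, side j i k hij.symm hkl.symm, neg_zero]
  rcases eq_or_ne j k with rfl | hjk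
  · rw [hA.1, hA.2.2.2, side j i l hij.symm hkl, neg_zero, neg_zero]
  · exact H R hR i j k l hij hik hil hjk hjl hkl

/-- Each term of the trace repeats an index in the outer slots, so the four indices of the support
cannot all occur. -/
theorem wedgeSym_mem_weyl (hsymm : B.IsSymm) (he : ∀ i j, i ≠ j → B (e i) (e j) = 0) (hab : a ≠ b)
    (hac : a ≠ c) (had : a ≠ d) (hbc : b ≠ c) (hbd : b ≠ d) (hcd : c ≠ d) :
    wedgeSym (e.coord a) (e.coord b) (e.coord c) (e.coord d) ∈ (weyl B hB).toSubmodule := by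
  refine ⟨e.ext fun j => e.ext fun k => ?_, wedgeSym_mem_algCurv _ _ _ _⟩
  rw [rho14_eq_sum_orthogonal hB hsymm he]
  refine Finset.sum_eq_zero fun i _ => ?_
  by_contra h
  obtain ⟨h1, h2, h3, h4⟩ := SupportedOn.wedgeSym _ _ _ _ (right_ne_zero_of_mul h)
  rcases h1 with rfl | rfl | rfl | rfl <;> rcases h2 with rfl | rfl | rfl | rfl <;>
    first
    | exact absurd rfl hab
    | (rcases h3 with rfl | rfl | rfl | rfl <;>
        first
        | exact absurd rfl hac
        | exact absurd rfl hbc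
        | (rcases h4 with rfl | rfl | rfl | rfl <;>
            first
            | exact absurd rfl had
            | exact absurd rfl hbd
            | exact absurd rfl hcd))

theorem form4_wedgeSym_ne_zero (hsymm : B.IsSymm) (he : ∀ i j, i ≠ j → B (e i) (e j) = 0)
    (hab : a ≠ b) (hac : a ≠ c) (had : a ≠ d) (hbc : b ≠ c) (hbd : b ≠ d) (hcd : c ≠ d) :
    form4 B hB (wedgeSym (e.coord a) (e.coord b) (e.coord c) (e.coord d))
      (wedgeSym (e.coord a) (e.coord b) (e.coord c) (e.coord d)) ≠ 0 := by
  obtain ⟨-, w2, -⟩ := wedgeSym_coord_apply (e := e) hab hac had hbc hbd hcd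
  have hs := SupportedOn.wedgeSym (e := e) (a := a) (b := b) (c := c) (d := d)
  set W := wedgeSym (e.coord a) (e.coord b) (e.coord c) (e.coord d)
  set w : ι → ℝ := fun i => (B (e i) (e i))⁻¹ with hwdef
  have hw : ∀ i, w i ≠ 0 := fun i =>
    inv_ne_zero (orthogonal_basis_apply_self_ne_zero hB he i)
  have h1 : form4 B hB W W = ∑ i, w i * ∑ j, w j * ∑ k, w k * ∑ l, w l *
      (W (e i) (e j) (e k) (e l) * W (e i) (e j) (e k) (e l)) := by
    simp only [form4, form2, traceForm_eq_sum hB hsymm he, LinearMap.mul_apply_apply, w]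
  -- On the support i, j, k, l is a permutation of a, b, c, d, so the weight is constant and a sum
  -- of squares is left.
  have h2 : ∀ i j k l, w i * (w j * (w k * (w l *
      (W (e i) (e j) (e k) (e l) * W (e i) (e j) (e k) (e l))))) =
      w a * w b * w c * w d * (W (e i) (e j) (e k) (e l) * W (e i) (e j) (e k) (e l)) := by
    intro i j k l
    by_cases h : W (e i) (e j) (e k) (e l) = 0
    · simp [h]
    · suffices w i * w j * w k * w l = w a * w b * w c * w d by rw [← this]; ring
      obtain ⟨h1, h2, h3, h4⟩ := hs _ _ _ _ h
      clear h w2 hs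
      rcases h1 with rfl | rfl | rfl | rfl <;> rcases h2 with rfl | rfl | rfl | rfl <;>
        first
        | exact absurd rfl hab
        | (rcases h3 with rfl | rfl | rfl | rfl <;>
            first
            | exact absurd rfl hac
            | exact absurd rfl hbc
            | (rcases h4 with rfl | rfl | rfl | rfl <;>
                first
                | exact absurd rfl had
                | exact absurd rfl hbd
                | exact absurd rfl hcd
                | ring))
  rw [h1]
  simp only [Finset.mul_sum, h2]
  simp only [← Finset.mul_sum]
  refine mul_ne_zero (mul_ne_zero (mul_ne_zero (mul_ne_zero (hw a) (hw b)) (hw c)) (hw d)) ?_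
  have h3 := sum_mul_self_ne_zero (n := ι × ι × ι × ι)
    (fun x => W (e x.1) (e x.2.1) (e x.2.2.1) (e x.2.2.2)) (i := (a, c, d, b))
    (by rw [w2]; norm_num)
  simpa only [Fintype.sum_prod_type] using h3

theorem isIrreducible_weyl (hm : 4 ≤ Module.finrank ℝ V) (hsymm : B.IsSymm)
    (hB : B.Nondegenerate) : (weyl B hB).toRepresentation.IsIrreducible := by
  obtain ⟨e, he⟩ := exists_orthogonal_basis hsymm
  let p : Fin 4 → Fin (Module.finrank ℝ V) := Fin.castLE hm
  have hp : Function.Injective p := Fin.castLE_injective hm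
  have h01 : p 0 ≠ p 1 := hp.ne (by decide)
  have h02 : p 0 ≠ p 2 := hp.ne (by decide)
  have h03 : p 0 ≠ p 3 := hp.ne (by decide)
  have h12 : p 1 ≠ p 2 := hp.ne (by decide)
  have h13 : p 1 ≠ p 3 := hp.ne (by decide)
  have h23 : p 2 ≠ p 3 := hp.ne (by decide)
  refine isIrreducible_of_forall_mem (weyl B hB) (form4 B hB) (form4_orep4 hB)
    (wedgeSym (e.coord (p 0)) (e.coord (p 1)) (e.coord (p 2)) (e.coord (p 3)))
    (form4_wedgeSym_ne_zero hsymm he h01 h02 h03 h12 h13 h23)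
    (wedgeSym_mem_weyl hsymm he h01 h02 h03 h12 h13 h23) fun N hN hG h0 => ?_
  have hA : N ≤ (algCurv V).toSubmodule := fun R hR => (hN hR).2
  have move : ∀ {a b c d : Fin (Module.finrank ℝ V)}, a ≠ b → a ≠ c → a ≠ d → b ≠ c → b ≠ d → c ≠ d →
      wedgeSym (e.coord a) (e.coord b) (e.coord c) (e.coord d) ∈ N →
      wedgeSym (e.coord (p 0)) (e.coord (p 1)) (e.coord (p 2)) (e.coord (p 3)) ∈ N :=
    fun hab hac had hbc hbd hcd h => forall_distinct_of_moves
      (P := fun a b c d => wedgeSym (e.coord a) (e.coord b) (e.coord c) (e.coord d) ∈ N)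
      (fun _ _ _ _ h => Eq.mp (congrArg (· ∈ N) (wedgeSym_comm_left _ _ _ _)) h)
      (fun _ _ _ _ h => Eq.mp (congrArg (· ∈ N) (wedgeSym_comm_right _ _ _ _)) h)
      (fun _ _ _ _ hab hac _ hbc hbd hcd h =>
        wedgeSym_mem_of_swap hsymm hB he hG hab hac hbc hbd hcd h)
      (fun _ _ _ _ _ had hbd hcd han hbn hcn h =>
        wedgeSym_mem_of_replace hsymm hB he hG had hbd hcd han hbn hcn h)
      hab hac had hbc hbd hcd h h01 h02 h03 h12 h13 h23
  obtain ⟨R, hR, a, b, c, d, hab, hac, had, hbc, hbd, hcd, h⟩ :=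
    exists_component_ne_zero_of_le_weyl hm hsymm he hN hG h0
  -- The three components sum to zero and the first is nonzero, so they are not all equal. Up to a
  -- cyclic shift of b, c, d, the second and third differ.
  have hbianchi : R (e a) (e b) (e c) (e d) + R (e a) (e c) (e d) (e b) +
      R (e a) (e d) (e b) (e c) = 0 := by
    have hRA := hA hR
    have h1 := hRA.2.1 (e b) (e c) (e d) (e a)
    rw [hRA.2.2.1 (e b) (e c) (e d) (e a), hRA.1 (e d), hRA.2.2.1 (e c) (e d) (e b) (e a),
      hRA.1 (e b), hRA.2.2.1 (e d) (e b) (e c) (e a), hRA.1 (e c)] at h1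
    rw [hRA.2.2.1 (e a) (e b) (e c) (e d), hRA.2.2.1 (e a) (e c) (e d) (e b),
      hRA.2.2.1 (e a) (e d) (e b) (e c)]
    linarith [hRA.2.2.1 (e a) (e b) (e c) (e d), hRA.2.2.1 (e a) (e c) (e d) (e b),
      hRA.2.2.1 (e a) (e d) (e b) (e c)]
  by_cases h1 : R (e a) (e c) (e d) (e b) = R (e a) (e d) (e b) (e c)
  · have h2 : R (e a) (e d) (e b) (e c) ≠ R (e a) (e b) (e c) (e d) := fun h2 => h (by linarith)
    exact move hac had hab hcd hbc.symm hbd.symm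
      (wedgeSym_mem_of_component_ne hsymm hB he hA hG hR hac had hab hcd hbc.symm hbd.symm h2)
  · exact move hab hac had hbc hbd hcd
      (wedgeSym_mem_of_component_ne hsymm hB he hA hG hR hab hac had hbc hbd hcd h1)

end Weyl

end AlgCurv

end

/-! ### The theorem assembled -/

theorem theorem3p2 {V : Type*} [AddCommGroup V] [Module ℝ V] [FiniteDimensional ℝ V]
    (hm : 4 ≤ Module.finrank ℝ V)
    (B : LinearMap.BilinForm ℝ V) (hsymm : B.IsSymm) (hB : B.Nondegenerate) :
    -- (1)
    (∀ R : AlgCurv.Tensor4 V, AlgCurv.AntisymmFirst R → AlgCurv.Bianchi R →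
      (AlgCurv.PairSymm R ↔ AlgCurv.AntisymmLast R)) ∧
    -- (2), the `GL(V)` equivariant sequence
    (∃ (i : (AlgCurv.algCurv V).toRepresentation.IntertwiningMap
          (AlgCurv.curv V).toRepresentation)
        (p : (AlgCurv.curv V).toRepresentation.IntertwiningMap
          (AlgCurv.altSym V).toRepresentation)
        (s : (AlgCurv.altSym V).toRepresentation.IntertwiningMap
          (AlgCurv.curv V).toRepresentation),
      (∀ A, (i A : AlgCurv.Tensor4 V) = A) ∧
      (∀ R, (p R : AlgCurv.Tensor4 V) = AlgCurv.idSym (R : AlgCurv.Tensor4 V)) ∧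
      (∀ S, (s S : AlgCurv.Tensor4 V) = AlgCurv.idSymSplit (S : AlgCurv.Tensor4 V)) ∧
      AlgCurv.IsSplitShortExact i p s) ∧
    -- (2), the `O(V, B)` equivariant sequence
    (∃ (i : (AlgCurv.weyl B hB).toRepresentation.IntertwiningMap
          (AlgCurv.oAlgCurv B).toRepresentation)
        (p : (AlgCurv.oAlgCurv B).toRepresentation.IntertwiningMap
          (AlgCurv.oSym2 B).toRepresentation)
        (s : (AlgCurv.oSym2 B).toRepresentation.IntertwiningMap
          (AlgCurv.oAlgCurv B).toRepresentation),
      (∀ A, (i A : AlgCurv.Tensor4 V) = A) ∧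
      (∀ A, (p A : AlgCurv.Tensor2 V) = AlgCurv.rho14 B hB (A : AlgCurv.Tensor4 V)) ∧
      (∀ ψ, (s ψ : AlgCurv.Tensor4 V) = AlgCurv.rho14Split B hB (ψ : AlgCurv.Tensor2 V)) ∧
      AlgCurv.IsSplitShortExact i p s) ∧
    -- (3), the decomposition given by the second sequence and `S²(V*) = S₀²(V*, B) ⊕ ℝ B`
    (∃ e : Representation.Equiv
        ((AlgCurv.weyl B hB).toRepresentation.prod
          ((AlgCurv.sym2Zero B hB).toRepresentation.prod
            (Representation.trivial ℝ (AlgCurv.orthogonalGroup B) ℝ)))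
        (AlgCurv.oAlgCurv B).toRepresentation,
      ∀ W ψ c, (e (W, ψ, c) : AlgCurv.Tensor4 V) =
        (W : AlgCurv.Tensor4 V) + AlgCurv.rho14Split B hB ((ψ : AlgCurv.Tensor2 V) + c • B)) ∧
    (AlgCurv.weyl B hB).toRepresentation.IsIrreducible ∧
    (AlgCurv.sym2Zero B hB).toRepresentation.IsIrreducible ∧
    (Representation.trivial ℝ (AlgCurv.orthogonalGroup B) ℝ).IsIrreducible ∧
    -- the dimensions
    (Module.finrank ℝ (AlgCurv.weyl B hB).toSubmodule : ℚ) =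
      1 / 12 * (Module.finrank ℝ V : ℚ) * ((Module.finrank ℝ V : ℚ) + 1) *
        ((Module.finrank ℝ V : ℚ) + 2) * ((Module.finrank ℝ V : ℚ) - 3) ∧
    (Module.finrank ℝ (AlgCurv.sym2Zero B hB).toSubmodule : ℚ) =
      1 / 2 * ((Module.finrank ℝ V : ℚ) - 1) * ((Module.finrank ℝ V : ℚ) + 2) ∧
    Module.finrank ℝ ℝ = 1 ∧
    (Module.finrank ℝ (AlgCurv.algCurv V).toSubmodule : ℚ) =
      1 / 12 * (Module.finrank ℝ V : ℚ) ^ 2 * ((Module.finrank ℝ V : ℚ) ^ 2 - 1) := by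
  obtain ⟨hz, hw⟩ := AlgCurv.finrank_sym2Zero_and_weyl hm hsymm hB
  have ha := AlgCurv.finrank_algCurv (V := V)
  have hs := AlgCurv.finrank_sym2 (V := V)
  refine ⟨fun R => AlgCurv.pairSymm_iff_antisymmLast, AlgCurv.exists_isSplitShortExact_curv,
    AlgCurv.exists_isSplitShortExact_oAlgCurv hm hsymm hB,
    AlgCurv.exists_equiv_oAlgCurv hm hsymm hB, AlgCurv.isIrreducible_weyl hm hsymm hB,
    AlgCurv.isIrreducible_sym2Zero hm hsymm hB, AlgCurv.isIrreducible_trivial _, ?_, ?_,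
    Module.finrank_self ℝ, ?_⟩
  -- The dimensions were computed as real traces; injectivity of ℚ → ℝ brings them back.
  · apply Rat.cast_injective (α := ℝ)
    push_cast
    linear_combination hw + ha - hs
  · apply Rat.cast_injective (α := ℝ)
    push_cast
    linear_combination hz + hs
  · apply Rat.cast_injective (α := ℝ)
    push_cast
    exact ha
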